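/- Let $N\in\mathbb N$, $1<p<N$, $s\in(0,1)$ and $p^*=\frac{Np}{N-p}$. For $u:\mathbb R^N\to\mathbb R$ put $$|D^su|^p(x)=\int_{\mathbb R^N}\frac{|u(x+h)-u(x)|^p}{|h|^{N+sp}}\,dh,\qquad [u]_{s,p}=\Big(\iint_{\mathbb R^{2N}}\frac{|u(x)-u(y)|^p}{|x-y|^{N+sp}}\,dx\,dy\Big)^{1/p},$$ let $\mathcal W_p$ be the closure of $C_c^\infty(\mathbb R^N)$ with respect to the norm $\rho_p(u)=\|\nabla u\|_{L^p}+[u]_{s,p}$ (realized as a space of functions in $L^{p^*}(\mathbb R^N)$ with a weak gradient $\nabla u$ and $\rho_p(u)<\infty$), and let $S_p$ be the best (largest) constant $C$ such that $C\|u\|_{L^{p^*}}^p\le\|\nabla u\|_{L^p}^p+[u]_{s,p}^p$ for all $u\in\mathcal W_p$. Let $(u_n)$ be a bounded sequence in $\mathcal W_p$ with $u_n\rightharpoonup u_0$ weakly in $\mathcal W_p$, and let $\mu_0,\nu_0$ be finite non-negative Borel measures on $\mathbb R^N$ such that $$(|\nabla u_n|^p+|D^su_n|^p)\,dx\overset{*}{\rightharpoonup}\mu_0,\qquad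 |u_n|^{p^*}\,dx\overset{*}{\rightharpoonup}\nu_0,$$ where weak* convergence is tested against continuous functions with compact support (so that the statement applies in particular when the convergence holds against all bounded continuous functions). Then there exist an at most countable index set $J$ and families $\{x_j\}_{j\in J}\subset\mathbb R^N$, $\{\mu_j\}_{j\in J}\subset(0,\infty)$, $\{\nu_j\}_{j\in J}\subset(0,\infty)$ such that $$\mu_0\ge(|\nabla u_0|^p+|D^su_0|^p)\,dx+\sum_{j\in J}\mu_j\delta_{x_j},\qquad \mu_j=\mu_0(\{x_j\}),$$ $$\nu_0=|u_0|^{p^*}\,dx+\sum_{j\in J}\nu_j\delta_{x_j},\qquad \nu_j=\nu_0(\{x_j\}),$$ $$S_p\,\nu_j^{p/p^*}\le\mu_j\quad\text{for every } j\in J.$$ -/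

import Mathlib

open MeasureTheory Filter Topology
open scoped ENNReal NNReal ContDiff

noncomputable section

namespace MixedSobolev

/-- The Euclidean space `ℝ^N`. -/
abbrev E (N : ℕ) : Type := EuclideanSpace ℝ (Fin N)

/-- The critical Sobolev exponent `p^* = N p / (N - p)` (used for `N > p`). -/
def pStar (N : ℕ) (p : ℝ) : ℝ := N * p / (N - p)

/-- `G` is the weak (distributional) gradient of `u` on `ℝ^N`:
`∫ u ∂_v φ = - ∫ φ ⟨G, v⟩` for all test functions `φ` and all directions `v`. -/
def IsWeakGradient {N : ℕ} (u : E N → ℝ) (G : E N → E N) : Prop :=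
  LocallyIntegrable u volume ∧ LocallyIntegrable G volume ∧
    ∀ φ : E N → ℝ, ContDiff ℝ ∞ φ → HasCompactSupport φ → ∀ v : E N,
      ∫ x, u x * fderiv ℝ φ x v = - ∫ x, φ x * inner ℝ (G x) v

open Classical in
/-- The weak gradient `∇u` (unique up to null sets; `0` if there is none). -/
def weakGrad {N : ℕ} (u : E N → ℝ) : E N → E N :=
  if h : ∃ G, IsWeakGradient u G then h.choose else 0

/-- The Gagliardo seminorm
`[u]_{s,p} = (∬ |u(x) - u(y)|^p / |x - y|^(N + s p) dx dy)^(1/p)`, with values in `[0, ∞]`. -/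
def gagliardo {N : ℕ} (s p : ℝ) (u : E N → ℝ) : ℝ≥0∞ :=
  (∫⁻ z : E N × E N, ‖u z.1 - u z.2‖ₑ ^ p / ‖z.1 - z.2‖ₑ ^ ((N : ℝ) + s * p)) ^ (1 / p)

/-- `|D^s u|^p (x) = ∫ |u(x + h) - u(x)|^p / |h|^(N + s p) dh`. -/
def fracDeriv {N : ℕ} (s p : ℝ) (u : E N → ℝ) (x : E N) : ℝ≥0∞ :=
  ∫⁻ h : E N, ‖u (x + h) - u x‖ₑ ^ p / ‖h‖ₑ ^ ((N : ℝ) + s * p)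

/-- `ρ_p(u) = ‖∇u‖_p + [u]_{s,p}`. -/
def rho {N : ℕ} (s p : ℝ) (u : E N → ℝ) : ℝ≥0∞ :=
  eLpNorm (weakGrad u) (ENNReal.ofReal p) volume + gagliardo s p u

/-- `u` lies in the closure of `C_c^∞(ℝ^N)` with respect to `ρ_p`, the closure being taken among
the functions in `L^{p^*}` that have a weak gradient and satisfy `ρ_p(u) < ∞`. -/
structure MemW {N : ℕ} (s p : ℝ) (u : E N → ℝ) : Prop where
  memLp : MemLp u (ENNReal.ofReal (pStar N p)) volume
  hasWeakGradient : ∃ G, IsWeakGradient u G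
  rho_lt_top : rho s p u < ⊤
  approx : ∃ φ : ℕ → E N → ℝ,
    (∀ k, ContDiff ℝ ∞ (φ k) ∧ HasCompactSupport (φ k)) ∧
      Tendsto (fun k => rho s p (u - φ k)) atTop (𝓝 0)

/-! Auxiliary facts: the functions in `MemW` form a vector space. -/

lemma IsWeakGradient.unique {N : ℕ} {u : E N → ℝ} {G H : E N → E N}
    (hG : IsWeakGradient u G) (hH : IsWeakGradient u H) : G =ᵐ[volume] H := by
  refine ae_eq_of_integral_contDiff_smul_eq hG.2.1 hH.2.1 fun g hg hc => ?_
  have key : ∀ {K : E N → E N}, LocallyIntegrable K volume →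
      Integrable (fun x => g x • K x) volume := fun hK =>
    hK.integrable_smul_left_of_hasCompactSupport hg.continuous hc
  refine ext_inner_left ℝ fun v => ?_
  rw [← integral_inner (key hG.2.1), ← integral_inner (key hH.2.1)]
  have h1 := hG.2.2 g hg hc v
  have h2 := hH.2.2 g hg hc v
  simp only [inner_smul_right, real_inner_comm v] at *
  linarith

lemma weakGrad_spec {N : ℕ} {u : E N → ℝ} (h : ∃ G, IsWeakGradient u G) :
    IsWeakGradient u (weakGrad u) := by
  rw [weakGrad, dif_pos h]
  exact h.choose_spec

lemma IsWeakGradient.ae_eq {N : ℕ} {u : E N → ℝ} {G : E N → E N}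
    (hG : IsWeakGradient u G) : weakGrad u =ᵐ[volume] G :=
  (weakGrad_spec ⟨G, hG⟩).unique hG

lemma integrable_mul_fderiv {N : ℕ} {u φ : E N → ℝ} (hu : LocallyIntegrable u volume)
    (hφ : ContDiff ℝ ∞ φ) (hc : HasCompactSupport φ) (v : E N) :
    Integrable (fun x => u x * fderiv ℝ φ x v) volume := by
  have h := hu.integrable_smul_left_of_hasCompactSupport (g := fun x => fderiv ℝ φ x v)
    ((hφ.continuous_fderiv (by simp)).clm_apply continuous_const) (hc.fderiv_apply ℝ v)
  simpa [mul_comm] using h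

lemma integrable_mul_inner {N : ℕ} {G : E N → E N} {φ : E N → ℝ} (hG : LocallyIntegrable G volume)
    (hφ : ContDiff ℝ ∞ φ) (hc : HasCompactSupport φ) (v : E N) :
    Integrable (fun x => φ x * inner ℝ (G x) v) volume := by
  have h := (hG.integrable_smul_left_of_hasCompactSupport hφ.continuous hc).inner_const (𝕜 := ℝ) v
  simpa [real_inner_smul_left] using h

lemma IsWeakGradient.add {N : ℕ} {u v : E N → ℝ} {G H : E N → E N}
    (hG : IsWeakGradient u G) (hH : IsWeakGradient v H) : IsWeakGradient (u + v) (G + H) := by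
  refine ⟨hG.1.add hH.1, hG.2.1.add hH.2.1, fun φ hφ hc w => ?_⟩
  have h1 := hG.2.2 φ hφ hc w
  have h2 := hH.2.2 φ hφ hc w
  simp only [Pi.add_apply, add_mul, inner_add_left, mul_add]
  rw [integral_add (integrable_mul_fderiv hG.1 hφ hc w) (integrable_mul_fderiv hH.1 hφ hc w),
    integral_add (integrable_mul_inner hG.2.1 hφ hc w) (integrable_mul_inner hH.2.1 hφ hc w)]
  linarith

lemma IsWeakGradient.smul {N : ℕ} {u : E N → ℝ} {G : E N → E N} (c : ℝ)
    (hG : IsWeakGradient u G) : IsWeakGradient (c • u) (c • G) := by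
  refine ⟨hG.1.smul c, hG.2.1.smul c, fun φ hφ hc w => ?_⟩
  have h1 := hG.2.2 φ hφ hc w
  simp only [Pi.smul_apply, smul_eq_mul, real_inner_smul_left, mul_assoc, mul_left_comm _ c]
  rw [integral_const_mul, integral_const_mul, h1]
  ring

lemma IsWeakGradient.of_contDiff {N : ℕ} {φ : E N → ℝ} (hφ : ContDiff ℝ ∞ φ) :
    IsWeakGradient φ (gradient φ) := by
  have hcont : Continuous (gradient φ) :=
    (InnerProductSpace.toDual ℝ (E N)).symm.continuous.comp (hφ.continuous_fderiv (by simp))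
  refine ⟨hφ.continuous.locallyIntegrable, hcont.locallyIntegrable, fun ψ hψ hc v => ?_⟩
  have hin : ∀ x, inner ℝ (gradient φ x) v = fderiv ℝ φ x v := fun x => by
    simp [gradient]
  have h1 := integrable_mul_fderiv hφ.continuous.locallyIntegrable hψ hc v
  have h2 := integrable_mul_inner hcont.locallyIntegrable hψ hc v
  simp only [hin] at h2 ⊢
  rw [integral_mul_fderiv_eq_neg_fderiv_mul_of_integrable (by simpa [mul_comm] using h2) h1]
  · simp [mul_comm]
  · have := hφ.continuous.locallyIntegrable.integrable_smul_left_of_hasCompactSupport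
      (μ := volume) hψ.continuous hc
    simpa [mul_comm] using this
  · exact fun x _ => hφ.differentiable (by simp) x
  · exact fun x _ => hψ.differentiable (by simp) x

lemma hasWeakGradient_sub {N : ℕ} {u φ : E N → ℝ} (hu : ∃ G, IsWeakGradient u G)
    (hφ : ContDiff ℝ ∞ φ) : ∃ G, IsWeakGradient (u - φ) G := by
  obtain ⟨G, hG⟩ := hu
  have h := hG.add ((IsWeakGradient.of_contDiff hφ).smul (-1))
  refine ⟨G + (-1 : ℝ) • gradient φ, ?_⟩
  convert h using 1
  ext x
  simp [sub_eq_add_neg]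

lemma gagliardo_add_le {N : ℕ} {s p : ℝ} (hp : 1 ≤ p) {u v : E N → ℝ}
    (hu : AEStronglyMeasurable u volume) (hv : AEStronglyMeasurable v volume) :
    gagliardo s p (u + v) ≤ gagliardo s p u + gagliardo s p v := by
  have hp0 : 0 < p := by linarith
  have hd : ∀ (a b : E N × E N → ℝ≥0∞),
      (fun z => a z ^ p / b z) = fun z => (a z / b z ^ (1 / p)) ^ p := fun a b => by
    ext z
    rw [ENNReal.div_rpow_of_nonneg _ _ hp0.le, ← ENNReal.rpow_mul,
      one_div_mul_cancel hp0.ne', ENNReal.rpow_one]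
  have hm : ∀ {w : E N → ℝ}, AEStronglyMeasurable w volume → AEMeasurable (fun z : E N × E N =>
      ‖w z.1 - w z.2‖ₑ / (‖z.1 - z.2‖ₑ ^ ((N : ℝ) + s * p)) ^ (1 / p)) volume := fun {w} hw => by
    have h1 : AEMeasurable (fun z : E N × E N => ‖w z.1 - w z.2‖ₑ) volume :=
      (hw.comp_fst.sub hw.comp_snd).enorm
    refine h1.div ?_
    fun_prop
  unfold gagliardo
  simp only [hd (fun z => ‖(u + v) z.1 - (u + v) z.2‖ₑ), hd (fun z => ‖u z.1 - u z.2‖ₑ),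
    hd (fun z => ‖v z.1 - v z.2‖ₑ)]
  refine le_trans ?_ (ENNReal.lintegral_Lp_add_le (hm hu) (hm hv) hp)
  gcongr with z
  simp only [Pi.add_apply]
  rw [← ENNReal.add_div]
  gcongr
  rw [add_sub_add_comm]
  exact enorm_add_le _ _

lemma gagliardo_smul {N : ℕ} {s p : ℝ} (hp : 1 ≤ p) (c : ℝ) (u : E N → ℝ) :
    gagliardo s p (c • u) = ‖c‖ₑ * gagliardo s p u := by
  have hp0 : 0 < p := by linarith
  unfold gagliardo
  simp only [Pi.smul_apply, ← smul_sub, enorm_smul, ENNReal.mul_rpow_of_nonneg _ _ hp0.le,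
    mul_div_assoc]
  rw [lintegral_const_mul' _ _ (by finiteness), ENNReal.mul_rpow_of_nonneg _ _ (by positivity),
    ← ENNReal.rpow_mul, mul_one_div_cancel hp0.ne', ENNReal.rpow_one]

lemma rho_add_le {N : ℕ} {s p : ℝ} (hp : 1 ≤ p) {u v : E N → ℝ}
    (hu : ∃ G, IsWeakGradient u G) (hv : ∃ G, IsWeakGradient v G) :
    rho s p (u + v) ≤ rho s p u + rho s p v := by
  have hu' := weakGrad_spec hu
  have hv' := weakGrad_spec hv
  have h1 : eLpNorm (weakGrad (u + v)) (ENNReal.ofReal p) volume ≤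
      eLpNorm (weakGrad u) (ENNReal.ofReal p) volume +
        eLpNorm (weakGrad v) (ENNReal.ofReal p) volume := by
    rw [eLpNorm_congr_ae (hu'.add hv').ae_eq]
    exact eLpNorm_add_le hu'.2.1.aestronglyMeasurable hv'.2.1.aestronglyMeasurable
      (ENNReal.one_le_ofReal.2 hp)
  have h2 := gagliardo_add_le (s := s) hp hu'.1.aestronglyMeasurable hv'.1.aestronglyMeasurable
  calc _ ≤ _ := add_le_add h1 h2
    _ = _ := add_add_add_comm _ _ _ _

lemma rho_smul {N : ℕ} {s p : ℝ} (hp : 1 ≤ p) (c : ℝ) {u : E N → ℝ}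
    (hu : ∃ G, IsWeakGradient u G) : rho s p (c • u) = ‖c‖ₑ * rho s p u := by
  rw [rho, rho, eLpNorm_congr_ae ((weakGrad_spec hu).smul c).ae_eq, eLpNorm_const_smul,
    gagliardo_smul hp, mul_add]

lemma MemW.add {N : ℕ} {s p : ℝ} (hp : 1 ≤ p) {u v : E N → ℝ} (hu : MemW s p u)
    (hv : MemW s p v) : MemW s p (u + v) := by
  refine ⟨hu.memLp.add hv.memLp, ⟨_, (weakGrad_spec hu.2).add (weakGrad_spec hv.2)⟩,
    (rho_add_le hp hu.2 hv.2).trans_lt (ENNReal.add_lt_top.2 ⟨hu.3, hv.3⟩), ?_⟩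
  obtain ⟨φ, hφ, hφt⟩ := hu.approx
  obtain ⟨ψ, hψ, hψt⟩ := hv.approx
  refine ⟨fun k => φ k + ψ k, fun k => ⟨(hφ k).1.add (hψ k).1, (hφ k).2.add (hψ k).2⟩, ?_⟩
  have h := hφt.add hψt
  rw [add_zero] at h
  refine tendsto_of_tendsto_of_tendsto_of_le_of_le tendsto_const_nhds h (fun _ => zero_le)
    fun k => ?_
  rw [add_sub_add_comm]
  exact rho_add_le hp (hasWeakGradient_sub hu.2 (hφ k).1) (hasWeakGradient_sub hv.2 (hψ k).1)

lemma MemW.smul {N : ℕ} {s p : ℝ} (hp : 1 ≤ p) (c : ℝ) {u : E N → ℝ} (hu : MemW s p u) :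
    MemW s p (c • u) := by
  refine ⟨hu.memLp.const_smul c, ⟨_, (weakGrad_spec hu.2).smul c⟩, ?_, ?_⟩
  · rw [rho_smul hp c hu.2]
    exact ENNReal.mul_lt_top (by finiteness) hu.3
  obtain ⟨φ, hφ, hφt⟩ := hu.approx
  refine ⟨fun k => c • φ k, fun k => ⟨(hφ k).1.const_smul c, (hφ k).2.smul_left (f := fun _ => c)⟩,
    ?_⟩
  have h := ENNReal.Tendsto.const_mul (a := ‖c‖ₑ) hφt (Or.inr (by finiteness))
  rw [mul_zero] at h
  refine h.congr fun k => ?_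
  rw [← smul_sub, rho_smul hp c (hasWeakGradient_sub hu.2 (hφ k).1)]

lemma MemW.zero {N : ℕ} {s p : ℝ} (hp : 1 ≤ p) : MemW s p (0 : E N → ℝ) := by
  have h0 : IsWeakGradient (0 : E N → ℝ) 0 := by
    refine ⟨locallyIntegrable_zero, locallyIntegrable_zero, fun φ _ _ v => by simp⟩
  have hr : rho s p (0 : E N → ℝ) = 0 := by
    have := rho_smul (s := s) hp 0 ⟨_, h0⟩
    simpa using this
  refine ⟨MemLp.zero, ⟨_, h0⟩, by simp [hr], fun _ => 0, fun _ => ⟨contDiff_const, ?_⟩, ?_⟩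
  · exact HasCompactSupport.zero
  · simp [hr]

/-- The solution space `𝒲_p`, the closure of `C_c^∞(ℝ^N)` for `ρ_p`, as a space of functions
(functions equal almost everywhere have `ρ_p`-distance zero). -/
def W (N : ℕ) (s p : ℝ) (hp : 1 ≤ p) : Submodule ℝ (E N → ℝ) where
  carrier := {u | MemW s p u}
  add_mem' hu hv := hu.add hp hv
  zero_mem' := MemW.zero hp
  smul_mem' c _ hu := hu.smul hp c

/-- `(u_n)` is bounded in `𝒲_p`. -/
def IsBoundedSeq {N : ℕ} {s p : ℝ} {hp : 1 ≤ p} (u : ℕ → W N s p hp) : Prop :=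
  ∃ C : ℝ≥0, ∀ n, rho s p (u n : E N → ℝ) ≤ C

/-- Weak convergence `u_n ⇀ u_0` in `𝒲_p`: convergence against every linear functional on `𝒲_p`
that is continuous for the norm `ρ_p`. -/
def WeaklyTendsto {N : ℕ} {s p : ℝ} {hp : 1 ≤ p} (u : ℕ → W N s p hp) (u₀ : W N s p hp) : Prop :=
  ∀ F : W N s p hp →ₗ[ℝ] ℝ,
    (∃ C : ℝ≥0, ∀ v, ‖F v‖ₑ ≤ C * rho s p (v : E N → ℝ)) →
      Tendsto (fun n => F (u n)) atTop (𝓝 (F u₀))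

/-- `S_p`, the best (largest) constant `C` in
`C ‖u‖_{p^*}^p ≤ ‖∇u‖_p^p + [u]_{s,p}^p` for all `u ∈ 𝒲_p`. -/
def bestConst (N : ℕ) (s p : ℝ) (hp : 1 ≤ p) : ℝ≥0∞ :=
  sSup {C : ℝ≥0∞ | ∀ u ∈ W N s p hp,
    C * eLpNorm u (ENNReal.ofReal (pStar N p)) volume ^ p ≤
      eLpNorm (weakGrad u) (ENNReal.ofReal p) volume ^ p + gagliardo s p u ^ p}

/-- The measure `(|∇u|^p + |D^s u|^p) dx`. -/
def energyMeasure {N : ℕ} (s p : ℝ) (u : E N → ℝ) : Measure (E N) :=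
  volume.withDensity fun x => ‖weakGrad u x‖ₑ ^ p + fracDeriv s p u x

/-- The measure `|u|^{p^*} dx`. -/
def criticalMeasure {N : ℕ} (p : ℝ) (u : E N → ℝ) : Measure (E N) :=
  volume.withDensity fun x => ‖u x‖ₑ ^ pStar N p

/-- Weak* convergence of measures on `ℝ^N`, tested against continuous functions with compact
support. It is implied by convergence against all continuous functions vanishing at infinity and
by convergence against all bounded continuous functions. -/
def WeakStarTendsto {N : ℕ} (μ : ℕ → Measure (E N)) (μ₀ : Measure (E N)) : Prop :=
  ∀ φ : E N → ℝ, Continuous φ → HasCompactSupport φ →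
    Tendsto (fun n => ∫ x, φ x ∂(μ n)) atTop (𝓝 (∫ x, φ x ∂μ₀))

end MixedSobolev

end

noncomputable section

namespace MixedSobolev

/-! Write `e` and `σ` for the energy and critical measures of `u₀`, `q` for `p^*` and `v_n = u_n -
u₀`. No Brezis–Lieb splitting is needed: Minkowski's inequality is enough, because every term it
wastes is absolutely continuous and so disappears at points.

For a test function `φ` and an admissible constant `c`, the Sobolev inequality is applied to `φ
v_n`. The product rule (`energy_mul_le`) bounds its energy by the energy of `v_n` weighted by
`|φ|^p`, plus an error `∫ |v_n|^p (|∇φ|^p + |D^s φ|^p)`. The error tends to zero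
(`tendsto_lintegral_rpow_mul`): the weight is bounded and integrable, `v_n` is `L^p`-close to its
averages over balls of radius `r` with error `O(r^s)` by the fractional energy, and the averages
tend to zero pointwise by weak convergence. Two triangle inequalities and a passage to the limit
(`sobolev_limit_le`), then to Borel sets (`measure_rpow_le_of_forall_contDiff`), give `c^{1/p}
ν₀(A)^{1/q} ≤ c^{1/p} σ(A)^{1/q} + μ₀(A)^{1/p} + e(A)^{1/p}`.

With `A` a point, `σ` and `e` vanish and the sharp inequality between the atoms remains. Away from
the atoms of `μ₀ + e`, a partition into sets of small measure and `p < q` make the last two terms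
negligible, so `ν₀ ≤ σ` there (`measure_le_of_rpow_le_of_no_atoms`). Together with `σ ≤ ν₀`
(`criticalMeasure_le`, Fatou) this shows that `ν₀` is `σ` plus its atoms. The bound for `μ₀` follows
from `e ≤ μ₀` (`energyMeasure_le`, lower semicontinuity), since `e` charges no countable set. -/

/-! ### From test functions to Borel sets. -/

open Manifold in
lemma exists_contDiff_eq_one_on_isCompact {N : ℕ} {K : Set (E N)} (hK : IsCompact K) {δ : ℝ}
    (hδ : 0 < δ) :
    ∃ φ : E N → ℝ, ContDiff ℝ ∞ φ ∧ HasCompactSupport φ ∧ (∀ x, 0 ≤ φ x) ∧ (∀ x, φ x ≤ 1) ∧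
      (∀ x ∈ K, φ x = 1) ∧ ∀ x, x ∉ Metric.cthickening δ K → φ x = 0 := by
  obtain ⟨φ, hφ, hr, hs, h1⟩ := exists_contMDiff_support_eq_eq_one_iff (n := (⊤ : ℕ∞)) 𝓘(ℝ, E N)
    (Metric.isOpen_thickening (δ := δ) (E := K)) hK.isClosed
    (Metric.self_subset_thickening hδ K)
  have h01 : ∀ x, φ x ∈ Set.Icc (0 : ℝ) 1 := fun x => hr ⟨x, rfl⟩
  refine ⟨φ, hφ.contDiff, ?_, fun x => (h01 x).1, fun x => (h01 x).2, fun x hx => (h1 x).1 hx,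
    fun x hx => ?_⟩
  · refine HasCompactSupport.intro (hK.cthickening (r := δ)) fun x hx => ?_
    by_contra h
    exact hx (Metric.thickening_subset_cthickening _ _ (hs ▸ h))
  · by_contra h
    exact hx (Metric.thickening_subset_cthickening _ _ (hs ▸ h))

lemma lintegral_enorm_rpow_le_measure {N : ℕ} {φ : E N → ℝ} {T : Set (E N)} {a : ℝ} (ha : 0 < a)
    (h0 : ∀ x, 0 ≤ φ x) (h1 : ∀ x, φ x ≤ 1) (hT : ∀ x, x ∉ T → φ x = 0) (hTm : MeasurableSet T)
    (τ : Measure (E N)) : ∫⁻ x, ‖φ x‖ₑ ^ a ∂τ ≤ τ T := by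
  rw [← lintegral_indicator_one hTm]
  refine lintegral_mono fun x => ?_
  by_cases hx : x ∈ T
  · rw [Set.indicator_of_mem hx]
    refine ENNReal.rpow_le_one ?_ ha.le
    rw [Real.enorm_of_nonneg (h0 x)]
    simpa using h1 x
  · simp [hT x hx, ha]

lemma measure_le_lintegral_enorm_rpow {N : ℕ} {φ : E N → ℝ} {K : Set (E N)} {a : ℝ}
    (hK : ∀ x ∈ K, φ x = 1) (hKm : MeasurableSet K) (τ : Measure (E N)) :
    τ K ≤ ∫⁻ x, ‖φ x‖ₑ ^ a ∂τ := by
  rw [← lintegral_indicator_one hKm]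
  refine lintegral_mono fun x => ?_
  by_cases hx : x ∈ K
  · simp [hx, hK x hx]
  · simp [hx]

/-- An inequality between `L^a`-norms of test functions passes to an inequality between measures
of Borel sets. -/
lemma measure_rpow_le_of_forall_contDiff {N : ℕ} {ν σ μ e : Measure (E N)} [IsFiniteMeasure ν]
    [IsFiniteMeasure σ] [IsFiniteMeasure μ] [IsFiniteMeasure e] {p q : ℝ} (hp : 0 < p)
    (hq : 0 < q) {c : ℝ≥0∞} (hc : c ≠ ⊤)
    (H : ∀ φ : E N → ℝ, ContDiff ℝ ∞ φ → HasCompactSupport φ → (∀ x, 0 ≤ φ x) →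
      c * (∫⁻ x, ‖φ x‖ₑ ^ q ∂ν) ^ (1 / q) ≤ c * (∫⁻ x, ‖φ x‖ₑ ^ q ∂σ) ^ (1 / q) +
        ((∫⁻ x, ‖φ x‖ₑ ^ p ∂μ) ^ (1 / p) + (∫⁻ x, ‖φ x‖ₑ ^ p ∂e) ^ (1 / p)))
    {A : Set (E N)} (hA : MeasurableSet A) :
    c * ν A ^ (1 / q) ≤ c * σ A ^ (1 / q) + (μ A ^ (1 / p) + e A ^ (1 / p)) := by
  have hq' : 0 < 1 / q := by positivity
  have hp' : 0 < 1 / p := by positivity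
  -- Compact sets first: a cutoff lies between the indicators of `K` and of its closed
  -- `δ`-thickening, whose finite measures decrease to those of `K` as `δ → 0`.
  have key : ∀ K : Set (E N), IsCompact K →
      c * ν K ^ (1 / q) ≤ c * σ K ^ (1 / q) + (μ K ^ (1 / p) + e K ^ (1 / p)) := by
    intro K hK
    have hcont : ∀ (τ : Measure (E N)) [IsFiniteMeasure τ] (a : ℝ), Tendsto
        (fun δ => τ (Metric.cthickening δ K) ^ a) (𝓝[>] 0) (𝓝 (τ K ^ a)) := fun τ _ a =>
      (ENNReal.continuous_rpow_const.tendsto _).comp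
        ((tendsto_measure_cthickening_of_isCompact hK).mono_left nhdsWithin_le_nhds)
    refine ge_of_tendsto ((ENNReal.Tendsto.const_mul (hcont σ _) (Or.inr hc)).add
      ((hcont μ _).add (hcont e _))) ?_
    filter_upwards [self_mem_nhdsWithin] with δ hδ
    obtain ⟨φ, hφ, hφc, h0, h1, hφK, hφT⟩ := exists_contDiff_eq_one_on_isCompact hK hδ
    have hT : MeasurableSet (Metric.cthickening δ K) := Metric.isClosed_cthickening.measurableSet
    have hle := fun (a : ℝ) (ha : 0 < a) => lintegral_enorm_rpow_le_measure ha h0 h1 hφT hT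
    calc c * ν K ^ (1 / q) ≤ c * (∫⁻ x, ‖φ x‖ₑ ^ q ∂ν) ^ (1 / q) := by
          gcongr
          exact measure_le_lintegral_enorm_rpow hφK hK.measurableSet ν
      _ ≤ _ := H φ hφ hφc h0
      _ ≤ _ := by
          gcongr
          exacts [hle q hq σ, hle p hp μ, hle p hp e]
  have hcont : Tendsto (fun t : ℝ≥0∞ => c * t ^ (1 / q)) (𝓝 (ν A)) (𝓝 (c * ν A ^ (1 / q))) :=
    ENNReal.Tendsto.const_mul (ENNReal.continuous_rpow_const.tendsto _) (Or.inr hc)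
  -- Inner regularity is needed for `ν` alone, since the right-hand side is monotone in the set. The
  -- case `ν A = 0` is separated because the limit `r ↑ ν A` is then empty.
  refine le_of_forall_lt fun t ht => ?_
  by_cases hν : ν A = 0
  · simp [hν, hq] at ht
  have hev : ∀ᶠ r in 𝓝[<] (ν A), t < c * r ^ (1 / q) ∧ r < ν A :=
    ((hcont.mono_left nhdsWithin_le_nhds).eventually_const_lt ht).and self_mem_nhdsWithin
  have : (𝓝[<] (ν A)).NeBot := nhdsLT_neBot_of_exists_lt ⟨0, pos_iff_ne_zero.2 hν⟩
  obtain ⟨r, hr1, hr2⟩ := hev.exists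
  obtain ⟨K, hKA, hK, hrK⟩ := hA.exists_lt_isCompact_of_ne_top (measure_ne_top ν A) hr2
  calc t < c * r ^ (1 / q) := hr1
    _ ≤ c * ν K ^ (1 / q) := by gcongr
    _ ≤ _ := key K hK
    _ ≤ _ := by gcongr

/-- The case `c = 1`, `μ = e = 0` of the preceding lemma, used for both lower semicontinuity
statements. -/
lemma measure_le_of_forall_contDiff {N : ℕ} {ν σ : Measure (E N)} [IsFiniteMeasure ν]
    [IsFiniteMeasure σ] {q : ℝ} (hq : 0 < q)
    (H : ∀ φ : E N → ℝ, ContDiff ℝ ∞ φ → HasCompactSupport φ → (∀ x, 0 ≤ φ x) →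
      ∫⁻ x, ‖φ x‖ₑ ^ q ∂ν ≤ ∫⁻ x, ‖φ x‖ₑ ^ q ∂σ) : ν ≤ σ := by
  refine Measure.le_iff.2 fun A hA => ?_
  have h := measure_rpow_le_of_forall_contDiff (ν := ν) (σ := σ) (μ := 0) (e := 0) (c := 1) hq hq
    (by simp) (fun φ h1 h2 h3 => by
      simpa [hq] using ENNReal.rpow_le_rpow (H φ h1 h2 h3) (by positivity : 0 ≤ 1 / q)) hA
  simp only [one_mul, Measure.coe_zero, Pi.zero_apply, ENNReal.zero_rpow_of_pos (one_div_pos.2 hq),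
    add_zero] at h
  exact (ENNReal.rpow_le_rpow_iff (by positivity)).1 h

/-! ### Atoms, and the absence of concentration away from them. -/

lemma countable_setOf_measure_singleton_ne_zero {X : Type*} [MeasurableSpace X]
    [MeasurableSingletonClass X] (m : Measure X) [IsFiniteMeasure m] :
    {x | m {x} ≠ 0}.Countable := by
  have := Measure.countable_meas_pos_of_disjoint_iUnion (μ := m) (As := fun x : X => {x})
    (fun x => measurableSet_singleton x) (fun x y hxy => by simpa [Function.onFun] using hxy)
  simpa [pos_iff_ne_zero] using this

/-- Outer regularity surrounds each non-atom by an open set of small measure, the Lindelöf property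
extracts a countable cover, and the cover is made disjoint. -/
lemma exists_measurable_partition_measure_lt {X : Type*} [MetricSpace X]
    [SecondCountableTopology X] [MeasurableSpace X] [BorelSpace X] (m : Measure X)
    [IsFiniteMeasure m] {B : Set X} (hB : MeasurableSet B) (hm : ∀ x ∈ B, m {x} = 0) {ε : ℝ≥0∞}
    (hε : 0 < ε) :
    ∃ A : ℕ → Set X, (∀ i, MeasurableSet (A i)) ∧ Pairwise (Function.onFun Disjoint A) ∧
      ⋃ i, A i = B ∧ ∀ i, m (A i) < ε := by
  have h1 : ∀ x : X, ∃ U : Set X, (x ∈ B → IsOpen U ∧ x ∈ U ∧ m U < ε) := by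
    intro x
    by_cases hx : x ∈ B
    · obtain ⟨U, hU, hUo, hUm⟩ := Set.exists_isOpen_lt_of_lt {x} ε (by rwa [hm x hx])
      exact ⟨U, fun _ => ⟨hUo, hU rfl, hUm⟩⟩
    · exact ⟨∅, fun h => absurd h hx⟩
  choose U hU using h1
  obtain ⟨t, htB, htc, ht⟩ := TopologicalSpace.countable_cover_nhdsWithin (f := U) (s := B)
    fun x hx => mem_nhdsWithin_of_mem_nhds ((hU x hx).1.mem_nhds (hU x hx).2.1)
  rcases Set.eq_empty_or_nonempty t with h | hne
  · refine ⟨fun _ => ∅, fun _ => .empty, fun _ _ _ => by simp [Function.onFun], ?_, by simpa using hε⟩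
    simpa [h, eq_comm] using ht
  obtain ⟨f, hf⟩ := htc.exists_eq_range hne
  have hfB : ∀ i, f i ∈ B := fun i => htB (hf ▸ Set.mem_range_self i)
  have hmeas : ∀ i, MeasurableSet (U (f i) ∩ B) := fun i =>
    (hU _ (hfB i)).1.measurableSet.inter hB
  refine ⟨disjointed fun i => U (f i) ∩ B, fun i => .disjointed hmeas i, disjoint_disjointed _, ?_,
    fun i => ?_⟩
  · rw [iUnion_disjointed, ← Set.iUnion_inter, Set.inter_eq_right]
    intro x hx
    have := ht hx
    rw [hf] at this
    simpa using this
  · exact (measure_mono ((disjointed_subset _ i).trans Set.inter_subset_left)).trans_lt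
      (hU _ (hfB i)).2.2

/-- A superlinear power bound by `m` is invisible away from the atoms of `m`. -/
lemma measure_le_of_rpow_le_of_no_atoms {X : Type*} [MetricSpace X]
    [SecondCountableTopology X] [MeasurableSpace X] [BorelSpace X] {ν σ m : Measure X}
    [IsFiniteMeasure m] {p q : ℝ} (hp : 0 < p) (hpq : p < q) (hq : 1 ≤ q) {K : ℝ≥0∞} (hK : K ≠ ⊤)
    (H : ∀ A, MeasurableSet A → ν A ^ (1 / q) ≤ σ A ^ (1 / q) + K * m A ^ (1 / p))
    {B : Set X} (hB : MeasurableSet B) (hm : ∀ x ∈ B, m {x} = 0) : ν B ≤ σ B := by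
  have hq0 : 0 < q := by linarith
  have hr : 0 < q / p - 1 := by rw [sub_pos, one_lt_div hp]; exact hpq
  -- On pieces with `m (A i) < ε` one has `m (A i) ^ (q / p) ≤ ε ^ (q / p - 1) * m (A i)`. This sums
  -- to a bound by `m B`, with a factor that vanishes with `ε` because `p < q`.
  have key : ∀ ε : ℝ≥0∞, 0 < ε → ν B ^ (1 / q) ≤
      σ B ^ (1 / q) + K * (ε ^ (q / p - 1) * m B) ^ (1 / q) := by
    intro ε hε
    obtain ⟨A, hA, hd, hAB, hAm⟩ := exists_measurable_partition_measure_lt m hB hm hε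
    have hsum : ∀ τ : Measure X, τ B = ∑' i, τ (A i) := fun τ => by
      rw [← hAB, measure_iUnion hd hA]
    have hinv : ∀ t : ℝ≥0∞, (t ^ (1 / q)) ^ q = t := fun t => by
      rw [← ENNReal.rpow_mul, one_div_mul_cancel hq0.ne', ENNReal.rpow_one]
    have h1 : ν B ≤ ∑' i, (σ (A i) ^ (1 / q) + K * m (A i) ^ (1 / p)) ^ q := by
      rw [hsum]
      refine ENNReal.tsum_le_tsum fun i => ?_
      rw [← hinv (ν (A i))]
      exact ENNReal.rpow_le_rpow (H _ (hA i)) hq0.le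
    -- Minkowski in `ℓ^q`, so that `σ B` keeps the factor one.
    have h2 := ENNReal.lintegral_Lp_add_le (μ := Measure.count) (p := q)
      (f := fun i : ℕ => σ (A i) ^ (1 / q)) (g := fun i : ℕ => K * m (A i) ^ (1 / p))
      (measurable_of_countable _).aemeasurable (measurable_of_countable _).aemeasurable hq
    simp only [lintegral_count, Pi.add_apply, hinv, ← hsum] at h2
    refine (ENNReal.rpow_le_rpow h1 (by positivity)).trans (h2.trans ?_)
    gcongr
    rw [show K * (ε ^ (q / p - 1) * m B) ^ (1 / q) =
      (K ^ q * (ε ^ (q / p - 1) * m B)) ^ (1 / q) by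
        rw [ENNReal.mul_rpow_of_nonneg (K ^ q) _ (by positivity), ← ENNReal.rpow_mul,
          mul_one_div_cancel hq0.ne', ENNReal.rpow_one]]
    gcongr
    rw [hsum, ← ENNReal.tsum_mul_left, ← ENNReal.tsum_mul_left]
    refine ENNReal.tsum_le_tsum fun i => ?_
    rw [ENNReal.mul_rpow_of_nonneg _ _ hq0.le, ← ENNReal.rpow_mul]
    gcongr
    rw [show 1 / p * q = (q / p - 1) + 1 by ring, ENNReal.rpow_add_of_nonneg _ _ hr.le zero_le_one,
      ENNReal.rpow_one]
    gcongr
    exact (hAm i).le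
  have hlim : Tendsto (fun ε : ℝ≥0∞ => σ B ^ (1 / q) + K * (ε ^ (q / p - 1) * m B) ^ (1 / q))
      (𝓝[>] 0) (𝓝 (σ B ^ (1 / q) + K * (0 ^ (q / p - 1) * m B) ^ (1 / q))) := by
    refine tendsto_const_nhds.add (ENNReal.Tendsto.const_mul ?_ (Or.inr hK))
    refine (ENNReal.continuous_rpow_const.tendsto _).comp ?_
    refine ENNReal.Tendsto.mul_const ?_ (Or.inr (measure_ne_top m B))
    exact (ENNReal.continuous_rpow_const.tendsto _).mono_left nhdsWithin_le_nhds
  rw [ENNReal.zero_rpow_of_pos hr, zero_mul, ENNReal.zero_rpow_of_pos (by positivity), mul_zero,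
    add_zero] at hlim
  have := ge_of_tendsto hlim (by filter_upwards [self_mem_nhdsWithin] with ε hε using key ε hε)
  exact (ENNReal.rpow_le_rpow_iff (by positivity)).1 this

/-! ### Powers of `L^p` norms and Minkowski's inequality. -/

lemma eLpNorm_ofReal_eq {α F : Type*} [MeasurableSpace α] [NormedAddCommGroup F] {μ : Measure α}
    {p : ℝ} (hp : 0 < p) (f : α → F) :
    eLpNorm f (ENNReal.ofReal p) μ = (∫⁻ x, ‖f x‖ₑ ^ p ∂μ) ^ (1 / p) := by
  rw [eLpNorm_eq_lintegral_rpow_enorm_toReal (by simpa using hp) ENNReal.ofReal_ne_top,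
    ENNReal.toReal_ofReal hp.le]

lemma rpow_one_div_rpow {p : ℝ} (hp : 0 < p) (t : ℝ≥0∞) : (t ^ (1 / p)) ^ p = t := by
  rw [← ENNReal.rpow_mul, one_div_mul_cancel hp.ne', ENNReal.rpow_one]

lemma rpow_rpow_one_div {p : ℝ} (hp : 0 < p) (t : ℝ≥0∞) : (t ^ p) ^ (1 / p) = t := by
  rw [← ENNReal.rpow_mul, mul_one_div_cancel hp.ne', ENNReal.rpow_one]

lemma eLpNorm_ofReal_rpow {α F : Type*} [MeasurableSpace α] [NormedAddCommGroup F] {μ : Measure α}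
    {p : ℝ} (hp : 0 < p) (f : α → F) :
    eLpNorm f (ENNReal.ofReal p) μ ^ p = ∫⁻ x, ‖f x‖ₑ ^ p ∂μ := by
  rw [eLpNorm_ofReal_eq hp, rpow_one_div_rpow hp]

lemma lintegral_rpow_le_add_rpow {α : Type*} [MeasurableSpace α] {κ : Measure α} {p : ℝ}
    (hp : 1 ≤ p) {a b c : α → ℝ≥0∞} (hb : AEMeasurable b κ) (hc : AEMeasurable c κ)
    (h : ∀ᵐ x ∂κ, a x ≤ b x + c x) :
    ∫⁻ x, a x ^ p ∂κ ≤ ((∫⁻ x, b x ^ p ∂κ) ^ (1 / p) + (∫⁻ x, c x ^ p ∂κ) ^ (1 / p)) ^ p := by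
  have hp0 : 0 < p := by linarith
  have h1 : ∫⁻ x, a x ^ p ∂κ ≤ ∫⁻ x, (b + c) x ^ p ∂κ :=
    lintegral_mono_ae (h.mono fun x hx => ENNReal.rpow_le_rpow hx hp0.le)
  refine h1.trans ?_
  rw [← rpow_one_div_rpow hp0 (∫⁻ x, (b + c) x ^ p ∂κ)]
  exact ENNReal.rpow_le_rpow (ENNReal.lintegral_Lp_add_le hb hc hp) hp0.le

/-- Minkowski's inequality for the `ℓ^p`-sum of two `L^p` norms. -/
lemma lintegral_add_lintegral_rpow_le {α β : Type*} [MeasurableSpace α] [MeasurableSpace β]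
    {μ : Measure α} {μ' : Measure β} {p : ℝ} (hp : 1 ≤ p) {f g h : α → ℝ≥0∞} {f' g' h' : β → ℝ≥0∞}
    (hg : AEMeasurable g μ) (hh : AEMeasurable h μ) (hg' : AEMeasurable g' μ')
    (hh' : AEMeasurable h' μ') (hf : ∀ᵐ x ∂μ, f x ≤ g x + h x)
    (hf' : ∀ᵐ x ∂μ', f' x ≤ g' x + h' x) :
    ((∫⁻ x, f x ^ p ∂μ) + ∫⁻ x, f' x ^ p ∂μ') ^ (1 / p) ≤
      ((∫⁻ x, g x ^ p ∂μ) + ∫⁻ x, g' x ^ p ∂μ') ^ (1 / p) +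
        ((∫⁻ x, h x ^ p ∂μ) + ∫⁻ x, h' x ^ p ∂μ') ^ (1 / p) := by
  have hp0 : 0 < p := by linarith
  have h2 := ENNReal.Lp_add_le Finset.univ
    ![(∫⁻ x, g x ^ p ∂μ) ^ (1 / p), (∫⁻ x, g' x ^ p ∂μ') ^ (1 / p)]
    ![(∫⁻ x, h x ^ p ∂μ) ^ (1 / p), (∫⁻ x, h' x ^ p ∂μ') ^ (1 / p)] hp
  simp only [Fin.sum_univ_two, Matrix.cons_val_zero, Matrix.cons_val_one,
    rpow_one_div_rpow hp0] at h2
  refine le_trans ?_ h2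
  gcongr
  exacts [lintegral_rpow_le_add_rpow hp hg hh hf, lintegral_rpow_le_add_rpow hp hg' hh' hf']

/-! ### Difference quotients and the energy measure. -/

/-- The difference quotient whose `p`-th power is the integrand of the Gagliardo seminorm. -/
def diffQuot {N : ℕ} (s p : ℝ) (u : E N → ℝ) (z : E N × E N) : ℝ≥0∞ :=
  ‖u z.1 - u z.2‖ₑ / ‖z.1 - z.2‖ₑ ^ (((N : ℝ) + s * p) / p)

lemma diffQuot_rpow {N : ℕ} {s p : ℝ} (hp : 0 < p) (u : E N → ℝ) (z : E N × E N) :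
    diffQuot s p u z ^ p = ‖u z.1 - u z.2‖ₑ ^ p / ‖z.1 - z.2‖ₑ ^ ((N : ℝ) + s * p) := by
  rw [diffQuot, ENNReal.div_rpow_of_nonneg _ _ hp.le, ← ENNReal.rpow_mul, div_mul_cancel₀ _ hp.ne']

lemma aemeasurable_diffQuot {N : ℕ} {s p : ℝ} {u : E N → ℝ} (hu : AEStronglyMeasurable u volume) :
    AEMeasurable (diffQuot s p u) (volume.prod volume) := by
  refine AEMeasurable.div (hu.comp_fst.sub hu.comp_snd).enorm ?_
  fun_prop

lemma fracDeriv_eq {N : ℕ} {s p : ℝ} (hp : 0 < p) (u : E N → ℝ) (x : E N) :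
    fracDeriv s p u x = ∫⁻ y, diffQuot s p u (x, y) ^ p := by
  rw [fracDeriv, ← lintegral_add_left_eq_self (fun y => diffQuot s p u (x, y) ^ p) x]
  refine lintegral_congr fun h => ?_
  rw [diffQuot_rpow hp]
  congr 2
  · rw [← enorm_neg, neg_sub]
  · simp

lemma aemeasurable_fracDeriv {N : ℕ} {s p : ℝ} (hp : 0 < p) {u : E N → ℝ}
    (hu : AEStronglyMeasurable u volume) : AEMeasurable (fracDeriv s p u) volume := by
  have : fracDeriv s p u = fun x => ∫⁻ y, diffQuot s p u (x, y) ^ p :=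
    funext fun x => fracDeriv_eq hp u x
  rw [this]
  exact ((aemeasurable_diffQuot hu).pow_const p).lintegral_prod_right'

lemma gagliardo_rpow {N : ℕ} {s p : ℝ} (hp : 0 < p) (u : E N → ℝ) :
    gagliardo s p u ^ p = ∫⁻ z, diffQuot s p u z ^ p ∂(volume.prod volume) := by
  rw [gagliardo, rpow_one_div_rpow hp]
  exact lintegral_congr fun z => (diffQuot_rpow hp u z).symm

lemma lintegral_mul_fracDeriv {N : ℕ} {s p : ℝ} (hp : 0 < p) {u : E N → ℝ}
    (hu : AEStronglyMeasurable u volume) {f : E N → ℝ≥0∞} (hf : AEMeasurable f volume) :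
    ∫⁻ x, f x * fracDeriv s p u x =
      ∫⁻ z : E N × E N, f z.1 * diffQuot s p u z ^ p ∂(volume.prod volume) := by
  have hm2 : AEMeasurable (fun z : E N × E N => f z.1 * diffQuot s p u z ^ p)
      (volume.prod volume) := hf.comp_fst.mul ((aemeasurable_diffQuot hu).pow_const p)
  rw [lintegral_prod _ hm2]
  have hm : ∀ᵐ x : E N, AEMeasurable (fun y => diffQuot s p u (x, y) ^ p) volume := by
    refine Eventually.of_forall fun x => ?_
    have : AEMeasurable (fun y => ‖u x - u y‖ₑ) volume :=
      (aestronglyMeasurable_const.sub hu).enorm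
    refine (AEMeasurable.div this ?_).pow_const p
    fun_prop
  refine lintegral_congr_ae (hm.mono fun x hx => ?_)
  simp only
  rw [fracDeriv_eq hp, lintegral_const_mul'' _ hx]

lemma lintegral_fracDeriv {N : ℕ} {s p : ℝ} (hp : 0 < p) {u : E N → ℝ}
    (hu : AEStronglyMeasurable u volume) : ∫⁻ x, fracDeriv s p u x = gagliardo s p u ^ p := by
  have := lintegral_mul_fracDeriv (s := s) hp hu (f := fun _ => 1) aemeasurable_const
  simpa [gagliardo_rpow hp] using this

lemma aemeasurable_enorm_weakGrad {N : ℕ} {u : E N → ℝ} (hu : ∃ G, IsWeakGradient u G) :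
    AEMeasurable (fun x => ‖weakGrad u x‖ₑ) volume :=
  (weakGrad_spec hu).2.1.aestronglyMeasurable.enorm

lemma aestronglyMeasurable_of_hasWeakGradient {N : ℕ} {u : E N → ℝ}
    (hu : ∃ G, IsWeakGradient u G) : AEStronglyMeasurable u volume :=
  (weakGrad_spec hu).1.aestronglyMeasurable

/-- In this form the weighted energy is an `ℓ^p`-sum of two `L^p` norms, to which Minkowski's
inequality applies. -/
lemma lintegral_energyMeasure {N : ℕ} {s p : ℝ} (hp : 0 < p) {u : E N → ℝ}
    (hu : ∃ G, IsWeakGradient u G) {φ : E N → ℝ} (hφ : Continuous φ) :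
    ∫⁻ x, ‖φ x‖ₑ ^ p ∂(energyMeasure s p u) =
    (∫⁻ x, (‖φ x‖ₑ * ‖weakGrad u x‖ₑ) ^ p) +
      ∫⁻ z : E N × E N, (‖φ z.1‖ₑ * diffQuot s p u z) ^ p ∂(volume.prod volume) := by
  have hum := aestronglyMeasurable_of_hasWeakGradient hu
  have hφm : Measurable fun x => ‖φ x‖ₑ ^ p := by fun_prop
  have hgm := (aemeasurable_enorm_weakGrad hu).pow_const p
  have hm : AEMeasurable (fun x => ‖weakGrad u x‖ₑ ^ p + fracDeriv s p u x) volume :=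
    hgm.add (aemeasurable_fracDeriv hp hum)
  rw [energyMeasure, lintegral_withDensity_eq_lintegral_mul₀ hm hφm.aemeasurable]
  simp only [Pi.mul_apply, add_mul]
  have hm1 : AEMeasurable (fun x => ‖weakGrad u x‖ₑ ^ p * ‖φ x‖ₑ ^ p) volume :=
    hgm.mul hφm.aemeasurable
  rw [lintegral_add_left' hm1]
  simp only [ENNReal.mul_rpow_of_nonneg _ _ hp.le]
  congr 1
  · simp only [mul_comm]
  · rw [← lintegral_mul_fracDeriv hp hum hφm.aemeasurable]
    simp only [mul_comm]

lemma energyMeasure_univ {N : ℕ} {s p : ℝ} (hp : 0 < p) {u : E N → ℝ}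
    (hu : ∃ G, IsWeakGradient u G) : energyMeasure s p u Set.univ =
      eLpNorm (weakGrad u) (ENNReal.ofReal p) volume ^ p + gagliardo s p u ^ p := by
  have := lintegral_energyMeasure (s := s) hp hu (φ := fun _ => 1) continuous_const
  rw [eLpNorm_ofReal_rpow hp, gagliardo_rpow hp, ← lintegral_one]
  simpa [-lintegral_const] using this

lemma IsWeakGradient.sub {N : ℕ} {u v : E N → ℝ} {G H : E N → E N}
    (hG : IsWeakGradient u G) (hH : IsWeakGradient v H) : IsWeakGradient (u - v) (G - H) := by
  simpa [sub_eq_add_neg] using hG.add (hH.smul (-1))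

lemma diffQuot_sub_le {N : ℕ} {s p : ℝ} (u v : E N → ℝ) (z : E N × E N) :
    diffQuot s p (u - v) z ≤ diffQuot s p u z + diffQuot s p v z := by
  rw [diffQuot, diffQuot, diffQuot, ← ENNReal.add_div]
  gcongr
  simp only [Pi.sub_apply]
  rw [sub_sub_sub_comm]
  exact enorm_sub_le

/-- Replaces the energy of `u_n - u₀`, whose limit is unknown, by that of `u_n`. The price is the
energy of `u₀`, which has no atoms. -/
lemma lintegral_energyMeasure_sub_le {N : ℕ} {s p : ℝ} (hp : 1 ≤ p) {u v : E N → ℝ}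
    (hu : ∃ G, IsWeakGradient u G) (hv : ∃ G, IsWeakGradient v G) {φ : E N → ℝ}
    (hφ : Continuous φ) :
    (∫⁻ x, ‖φ x‖ₑ ^ p ∂(energyMeasure s p (u - v))) ^ (1 / p) ≤
      (∫⁻ x, ‖φ x‖ₑ ^ p ∂(energyMeasure s p u)) ^ (1 / p) +
        (∫⁻ x, ‖φ x‖ₑ ^ p ∂(energyMeasure s p v)) ^ (1 / p) := by
  have hp0 : 0 < p := by linarith
  have hsub := (weakGrad_spec hu).sub (weakGrad_spec hv)
  have hm1 : AEMeasurable (fun x => ‖φ x‖ₑ) volume := by fun_prop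
  have hm2 : AEMeasurable (fun z : E N × E N => ‖φ z.1‖ₑ) (volume.prod volume) := by fun_prop
  rw [lintegral_energyMeasure hp0 ⟨_, hsub⟩ hφ, lintegral_energyMeasure hp0 hu hφ,
    lintegral_energyMeasure hp0 hv hφ]
  refine lintegral_add_lintegral_rpow_le hp (hm1.mul (aemeasurable_enorm_weakGrad hu))
    (hm1.mul (aemeasurable_enorm_weakGrad hv))
    (hm2.mul (aemeasurable_diffQuot (aestronglyMeasurable_of_hasWeakGradient hu)))
    (hm2.mul (aemeasurable_diffQuot (aestronglyMeasurable_of_hasWeakGradient hv))) ?_ ?_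
  · filter_upwards [hsub.ae_eq] with x hx
    rw [hx, ← mul_add]
    gcongr
    exact enorm_sub_le
  · refine Eventually.of_forall fun z => ?_
    rw [← mul_add]
    gcongr
    exact diffQuot_sub_le u v z

/-! ### The product rule for the mixed energy. -/

lemma continuous_gradient {N : ℕ} {φ : E N → ℝ} (hφ : ContDiff ℝ ∞ φ) :
    Continuous (gradient φ) :=
  (InnerProductSpace.toDual ℝ (E N)).symm.continuous.comp (hφ.continuous_fderiv (by simp))

lemma hasCompactSupport_gradient {N : ℕ} {φ : E N → ℝ} (hc : HasCompactSupport φ) :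
    HasCompactSupport (gradient φ) :=
  (hc.fderiv ℝ).comp_left (g := (InnerProductSpace.toDual ℝ (E N)).symm) (map_zero _)

lemma inner_gradient {N : ℕ} (φ : E N → ℝ) (x v : E N) :
    inner ℝ (gradient φ x) v = fderiv ℝ φ x v := by
  simp [gradient]

lemma IsWeakGradient.mul_contDiff {N : ℕ} {u φ : E N → ℝ} {G : E N → E N}
    (hG : IsWeakGradient u G) (hφ : ContDiff ℝ ∞ φ) (hc : HasCompactSupport φ) :
    IsWeakGradient (fun x => φ x * u x) (fun x => φ x • G x + u x • gradient φ x) := by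
  have i1 : Integrable (fun x => φ x * u x) volume := by
    simpa using hG.1.integrable_smul_left_of_hasCompactSupport hφ.continuous hc
  have i2 : Integrable (fun x => φ x • G x) volume :=
    hG.2.1.integrable_smul_left_of_hasCompactSupport hφ.continuous hc
  have i3 : Integrable (fun x => u x • gradient φ x) volume :=
    hG.1.integrable_smul_right_of_hasCompactSupport (continuous_gradient hφ)
      (hasCompactSupport_gradient hc)
  refine ⟨i1.locallyIntegrable, i2.locallyIntegrable.add i3.locallyIntegrable,
    fun ψ hψ hψc v => ?_⟩
  have h := hG.2.2 (fun x => φ x * ψ x) (hφ.mul hψ) hc.mul_right v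
  have hfd : ∀ x, fderiv ℝ (fun x => φ x * ψ x) x v =
      φ x * fderiv ℝ ψ x v + ψ x * fderiv ℝ φ x v := fun x => by
    rw [fderiv_fun_mul (hφ.differentiable (by simp) x) (hψ.differentiable (by simp) x)]
    simp
  have j1 := integrable_mul_fderiv i1.locallyIntegrable hψ hψc v
  have j2 := integrable_mul_inner i3.locallyIntegrable hψ hψc v
  have j3 := integrable_mul_inner i2.locallyIntegrable hψ hψc v
  simp only [hfd, inner_add_left, real_inner_smul_left, inner_gradient, mul_add] at h j2 j3 ⊢
  rw [integral_add j3 j2]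
  have e1 : ∫ x, (u x * (φ x * fderiv ℝ ψ x v) + u x * (ψ x * fderiv ℝ φ x v)) =
      (∫ x, φ x * u x * fderiv ℝ ψ x v) + ∫ x, ψ x * (u x * fderiv ℝ φ x v) := by
    rw [← integral_add j1 j2]
    congr 1 with x
    ring
  rw [e1] at h
  have e2 : ∫ x, ψ x * (φ x * inner ℝ (G x) v) = ∫ x, φ x * ψ x * inner ℝ (G x) v := by
    congr 1 with x
    ring
  rw [e2]
  linarith

/-- The splitting is deliberately asymmetric: `φ` is evaluated at the first variable, the base point
of the energy density of `w`, and `w` at the second. -/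
lemma diffQuot_mul_le {N : ℕ} {s p : ℝ} (φ w : E N → ℝ) (z : E N × E N) :
    diffQuot s p (fun x => φ x * w x) z ≤
      ‖φ z.1‖ₑ * diffQuot s p w z + ‖w z.2‖ₑ * diffQuot s p φ z := by
  rw [diffQuot, diffQuot, diffQuot, ← mul_div_assoc, ← mul_div_assoc, ← ENNReal.add_div]
  gcongr
  rw [← enorm_mul, ← enorm_mul, show φ z.1 * w z.1 - φ z.2 * w z.2 =
    φ z.1 * (w z.1 - w z.2) + w z.2 * (φ z.1 - φ z.2) by ring]
  exact enorm_add_le _ _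

lemma diffQuot_swap {N : ℕ} {s p : ℝ} (u : E N → ℝ) (z : E N × E N) :
    diffQuot s p u z.swap = diffQuot s p u z := by
  simp only [diffQuot, Prod.fst_swap, Prod.snd_swap]
  rw [← enorm_neg, neg_sub, ← enorm_neg (z.2 - z.1), neg_sub]

/-- The product rule for the mixed energy. -/
lemma energy_mul_le {N : ℕ} {s p : ℝ} (hp : 1 ≤ p) {w φ : E N → ℝ}
    (hw : ∃ G, IsWeakGradient w G) (hφ : ContDiff ℝ ∞ φ) (hc : HasCompactSupport φ) :
    (eLpNorm (weakGrad fun x => φ x * w x) (ENNReal.ofReal p) volume ^ p +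
        gagliardo s p (fun x => φ x * w x) ^ p) ^ (1 / p) ≤
      (∫⁻ x, ‖φ x‖ₑ ^ p ∂(energyMeasure s p w)) ^ (1 / p) +
        (∫⁻ x, ‖w x‖ₑ ^ p * (‖gradient φ x‖ₑ ^ p + fracDeriv s p φ x)) ^ (1 / p) := by
  have hp0 : 0 < p := by linarith
  have hprod := (weakGrad_spec hw).mul_contDiff hφ hc
  have hwm := aestronglyMeasurable_of_hasWeakGradient hw
  have hφm := hφ.continuous.aestronglyMeasurable (μ := (volume : Measure (E N)))
  have hm1 : AEMeasurable (fun x => ‖φ x‖ₑ) volume := hφm.enorm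
  have hm2 : AEMeasurable (fun z : E N × E N => ‖φ z.1‖ₑ) (volume.prod volume) :=
    hφm.comp_fst.enorm
  have hm3 : AEMeasurable (fun x => ‖w x‖ₑ * ‖gradient φ x‖ₑ) volume :=
    hwm.enorm.mul (continuous_gradient hφ).aestronglyMeasurable.enorm
  have hm4 : AEMeasurable (fun z : E N × E N => ‖w z.2‖ₑ * diffQuot s p φ z)
      (volume.prod volume) := hwm.comp_snd.enorm.mul (aemeasurable_diffQuot hφm)
  -- Exchanging the two variables turns the point at which `w` is evaluated into the base point of
  -- `fracDeriv s p φ`.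
  have hR : ∫⁻ x, ‖w x‖ₑ ^ p * (‖gradient φ x‖ₑ ^ p + fracDeriv s p φ x) =
      (∫⁻ x, (‖w x‖ₑ * ‖gradient φ x‖ₑ) ^ p) +
        ∫⁻ z : E N × E N, (‖w z.2‖ₑ * diffQuot s p φ z) ^ p ∂(volume.prod volume) := by
    have hm5 : AEMeasurable (fun x => ‖w x‖ₑ ^ p * ‖gradient φ x‖ₑ ^ p) volume := by
      simpa only [ENNReal.mul_rpow_of_nonneg _ _ hp0.le] using hm3.pow_const p
    simp only [mul_add, ENNReal.mul_rpow_of_nonneg _ _ hp0.le]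
    rw [lintegral_add_left' hm5, lintegral_mul_fracDeriv hp0 hφm (hwm.enorm.pow_const p),
      ← lintegral_prod_swap]
    simp only [diffQuot_swap, Prod.fst_swap]
  rw [eLpNorm_ofReal_rpow hp0, gagliardo_rpow hp0, lintegral_energyMeasure hp0 hw hφ.continuous, hR]
  refine lintegral_add_lintegral_rpow_le hp (hm1.mul (aemeasurable_enorm_weakGrad hw)) hm3
    (hm2.mul (aemeasurable_diffQuot hwm)) hm4 ?_
    (Eventually.of_forall fun z => diffQuot_mul_le φ w z)
  filter_upwards [hprod.ae_eq] with x hx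
  rw [hx, ← enorm_smul, ← enorm_smul]
  exact enorm_add_le _ _

/-! ### The critical exponent and the Sobolev inequality. -/

lemma pStar_pos {N : ℕ} {p : ℝ} (hp : 1 < p) (hpN : p < N) : 0 < pStar N p :=
  div_pos (mul_pos (by linarith) (by linarith)) (by linarith)

lemma lt_pStar {N : ℕ} {p : ℝ} (hp : 1 < p) (hpN : p < N) : p < pStar N p := by
  rw [pStar, lt_div_iff₀ (by linarith)]
  nlinarith

lemma one_le_pStar {N : ℕ} {p : ℝ} (hp : 1 < p) (hpN : p < N) : 1 ≤ pStar N p :=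
  (hp.trans (lt_pStar hp hpN)).le

lemma nontrivial_of_lt {N : ℕ} {p : ℝ} (hp : 1 < p) (hpN : p < N) : Nontrivial (E N) := by
  have : 0 < N := by
    have : (0 : ℝ) < N := by linarith
    exact_mod_cast this
  have : Nonempty (Fin N) := ⟨⟨0, this⟩⟩
  infer_instance

lemma enorm_gradient {N : ℕ} (φ : E N → ℝ) (x : E N) : ‖gradient φ x‖ₑ = ‖fderiv ℝ φ x‖ₑ := by
  rw [← ofReal_norm, ← ofReal_norm, gradient, LinearIsometryEquiv.norm_map]

lemma eLpNorm_weakGrad_of_contDiff {N : ℕ} {φ : E N → ℝ} (hφ : ContDiff ℝ ∞ φ) (r : ℝ≥0∞) :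
    eLpNorm (weakGrad φ) r volume = eLpNorm (fderiv ℝ φ) r volume := by
  rw [eLpNorm_congr_ae (IsWeakGradient.of_contDiff hφ).ae_eq]
  exact eLpNorm_congr_enorm_ae (Eventually.of_forall fun x => enorm_gradient φ x)

lemma exists_sobolev_contDiff {N : ℕ} {p : ℝ} (hp : 1 < p) (hpN : p < N) :
    ∃ K : ℝ≥0, ∀ φ : E N → ℝ, ContDiff ℝ ∞ φ → HasCompactSupport φ →
      eLpNorm φ (ENNReal.ofReal (pStar N p)) volume ≤
        K * eLpNorm (weakGrad φ) (ENNReal.ofReal p) volume := by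
  have hN0 : (0 : ℝ) < N := by linarith
  refine ⟨SNormLESNormFDerivOfEqConst ℝ (volume : Measure (E N)) p.toNNReal, fun φ hφ hc => ?_⟩
  rw [eLpNorm_weakGrad_of_contDiff hφ]
  refine eLpNorm_le_eLpNorm_fderiv_of_eq volume (hφ.of_le (by simp)) hc (p := p.toNNReal)
    (p' := (pStar N p).toNNReal) ?_ ?_ ?_
  · simpa using hp.le
  · rw [finrank_euclideanSpace_fin]
    exact_mod_cast hN0
  · rw [finrank_euclideanSpace_fin, Real.coe_toNNReal _ (pStar_pos hp hpN).le,
      NNReal.coe_inv, Real.coe_toNNReal p (by linarith), pStar]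
    have : (N : ℝ) - p ≠ 0 := by linarith
    have : p ≠ 0 := by linarith
    field_simp

/-- By Fubini a single good base point `x` is enough: the quotient vanishes for almost every `y`,
its denominator is finite, so `w y = w x`. -/
lemma ae_eq_const_of_gagliardo_eq_zero {N : ℕ} {s p : ℝ} (hp : 0 < p) (hs : 0 < s) {w : E N → ℝ}
    (hw : AEStronglyMeasurable w volume) (h : gagliardo s p w = 0) :
    ∃ c, w =ᵐ[volume] fun _ => c := by
  have h1 : ∫⁻ z, diffQuot s p w z ^ p ∂(volume.prod volume) = 0 := by
    rw [← gagliardo_rpow hp, h, ENNReal.zero_rpow_of_pos hp]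
  rw [lintegral_eq_zero_iff' ((aemeasurable_diffQuot hw).pow_const p)] at h1
  obtain ⟨x, hx⟩ := (Measure.ae_ae_of_ae_prod h1).exists
  refine ⟨w x, hx.mono fun y hy => ?_⟩
  have h2 : diffQuot s p w (x, y) = 0 := by
    simpa [hp, hp.le, hp.not_gt] using hy
  rw [diffQuot, ENNReal.div_eq_zero_iff] at h2
  rcases h2 with h2 | h2
  · have := enorm_eq_zero.1 h2
    simp only at this
    linarith
  · exact absurd h2 (ENNReal.rpow_ne_top_of_nonneg (by positivity) enorm_ne_top)

lemma gagliardo_rpow_le_liminf {N : ℕ} {s p : ℝ} (hp : 0 < p) {f : ℕ → E N → ℝ} {w : E N → ℝ}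
    (hf : ∀ k, AEStronglyMeasurable (f k) volume)
    (h : ∀ᵐ x, Tendsto (fun k => f k x) atTop (𝓝 (w x))) :
    gagliardo s p w ^ p ≤ liminf (fun k => gagliardo s p (f k) ^ p) atTop := by
  simp only [gagliardo_rpow hp]
  refine le_trans ?_ (lintegral_liminf_le' fun k => (aemeasurable_diffQuot (hf k)).pow_const p)
  have h1 : ∀ᵐ z : E N × E N ∂(volume.prod volume),
      Tendsto (fun k => f k z.1) atTop (𝓝 (w z.1)) := Measure.quasiMeasurePreserving_fst.ae h
  have h2 : ∀ᵐ z : E N × E N ∂(volume.prod volume),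
      Tendsto (fun k => f k z.2) atTop (𝓝 (w z.2)) := Measure.quasiMeasurePreserving_snd.ae h
  refine lintegral_mono_ae ?_
  filter_upwards [h1, h2] with z hz1 hz2
  refine (Tendsto.liminf_eq ?_).ge
  simp only [diffQuot_rpow hp, div_eq_mul_inv]
  -- On the diagonal all numerators vanish. Off it the kernel is finite, as continuity of
  -- multiplication in `ℝ≥0∞` requires.
  by_cases hz : z.1 = z.2
  · simp [hz, hp]
  refine ENNReal.Tendsto.mul_const ?_ (Or.inr ?_)
  · exact (ENNReal.continuous_rpow_const.tendsto _).comp ((hz1.sub hz2).enorm)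
  · simp [sub_eq_zero, hz]

/-- The Sobolev inequality on `𝒲_p`. -/
lemma exists_sobolev {N : ℕ} {s p : ℝ} (hs : 0 < s) (hp : 1 < p) (hpN : p < N) :
    ∃ K : ℝ≥0, ∀ u : E N → ℝ, MemW s p u →
      eLpNorm u (ENNReal.ofReal (pStar N p)) volume ≤
        K * eLpNorm (weakGrad u) (ENNReal.ofReal p) volume := by
  obtain ⟨K, hK⟩ := exists_sobolev_contDiff (N := N) hp hpN
  refine ⟨K, fun u hu => ?_⟩
  have hp0 : 0 < p := by linarith
  have := nontrivial_of_lt hp hpN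
  have hq1 : 1 ≤ ENNReal.ofReal (pStar N p) := by simpa using one_le_pStar hp hpN
  set q := ENNReal.ofReal (pStar N p)
  have : Fact (1 ≤ q) := ⟨hq1⟩
  obtain ⟨φ, hφ, hlim⟩ := hu.approx
  have hgr : ∀ k, ∃ G, IsWeakGradient (φ k) G := fun k => ⟨_, .of_contDiff (hφ k).1⟩
  have hφL : ∀ k, MemLp (φ k) q volume := fun k =>
    (hφ k).1.continuous.memLp_of_hasCompactSupport (hφ k).2
  have hdiff : ∀ k l, eLpNorm (φ k - φ l) q volume ≤
      K * (rho s p (u - φ l) + rho s p (u - φ k)) := fun k l => by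
    refine (hK (φ k - φ l) ((hφ k).1.sub (hφ l).1) ((hφ k).2.sub (hφ l).2)).trans ?_
    gcongr
    have h1 := weakGrad_spec (hasWeakGradient_sub hu.2 (hφ l).1)
    have h2 := weakGrad_spec (hasWeakGradient_sub hu.2 (hφ k).1)
    have h3 := h1.sub h2
    rw [sub_sub_sub_cancel_left] at h3
    rw [eLpNorm_congr_ae h3.ae_eq]
    refine (eLpNorm_sub_le h1.2.1.aestronglyMeasurable h2.2.1.aestronglyMeasurable
      (by simpa using hp.le)).trans ?_
    exact add_le_add le_self_add le_self_add
  -- Approximation in `ρ_p` says nothing directly about `L^{p^*}`. The smooth inequality makes the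
  -- approximants Cauchy there, and their limit `f` has to be identified with `u`.
  have hcau : CauchySeq fun k => (hφL k).toLp (φ k) := by
    refine EMetric.cauchySeq_iff.2 fun ε hε => ?_
    have h0 : Tendsto (fun z : ℕ × ℕ => (K : ℝ≥0∞) * (rho s p (u - φ z.2) + rho s p (u - φ z.1)))
        atTop (𝓝 (K * (0 + 0))) := by
      rw [← prod_atTop_atTop_eq]
      exact ENNReal.Tendsto.const_mul ((hlim.comp tendsto_snd).add (hlim.comp tendsto_fst))
        (Or.inr ENNReal.coe_ne_top)
    rw [add_zero, mul_zero] at h0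
    have h1 := h0.eventually_lt_const hε
    rw [eventually_atTop_prod_self] at h1
    obtain ⟨n, hn⟩ := h1
    refine ⟨n, fun k hk l hl => ?_⟩
    rw [Lp.edist_toLp_toLp]
    exact (hdiff k l).trans_lt (hn k l hk hl)
  obtain ⟨f, hf⟩ := cauchySeq_tendsto_of_complete hcau
  have hfL : MemLp f q volume := Lp.memLp f
  have hfl : Tendsto (fun k => eLpNorm (φ k - ⇑f) q volume) atTop (𝓝 0) := by
    have h1 := (Lp.tendsto_Lp_iff_tendsto_eLpNorm' _ f).1 hf
    refine h1.congr fun k => eLpNorm_congr_ae ?_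
    filter_upwards [(hφL k).coeFn_toLp] with x hx
    simp [hx]
  obtain ⟨ns, hns, hae⟩ := (tendstoInMeasure_of_tendsto_eLpNorm (by positivity)
    (fun k => (hφL k).1) hfL.1 hfl).exists_seq_tendsto_ae
  have hum := aestronglyMeasurable_of_hasWeakGradient hu.2
  -- Fatou along an almost everywhere convergent subsequence. Hence `u - f` is constant, and the
  -- constant is zero because the whole space has infinite measure.
  have hg0 : gagliardo s p (u - ⇑f) = 0 := by
    have h1 := gagliardo_rpow_le_liminf (s := s) (f := fun k => u - φ (ns k)) (w := u - ⇑f) hp0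
      (fun k => hum.sub (hφL _).1) (hae.mono fun x hx => hx.const_sub _)
    have h2 : Tendsto (fun k => gagliardo s p (u - φ (ns k)) ^ p) atTop (𝓝 (0 ^ p)) := by
      refine (ENNReal.continuous_rpow_const.tendsto _).comp ?_
      exact tendsto_of_tendsto_of_tendsto_of_le_of_le tendsto_const_nhds
        (hlim.comp hns.tendsto_atTop) (fun _ => zero_le) fun _ => le_add_self
    rw [h2.liminf_eq, ENNReal.zero_rpow_of_pos hp0] at h1
    simpa [hp0, hp0.le, hp0.not_gt] using h1
  obtain ⟨c, hc⟩ := ae_eq_const_of_gagliardo_eq_zero hp0 hs (hum.sub hfL.1) hg0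
  have hc0 : c = 0 := by
    have h1 : MemLp (fun _ : E N => c) q volume := (hu.memLp.sub hfL).ae_eq hc
    rw [memLp_const_iff (by positivity) ENNReal.ofReal_ne_top] at h1
    simpa using h1
  have huf : u =ᵐ[volume] f := by
    filter_upwards [hc] with x hx
    simpa [hc0, sub_eq_zero] using hx
  rw [eLpNorm_congr_ae huf]
  have hle : ∀ k, eLpNorm f q volume ≤ eLpNorm (φ k - ⇑f) q volume +
      K * (eLpNorm (weakGrad u) (ENNReal.ofReal p) volume + rho s p (u - φ k)) := fun k => by
    have h1 : eLpNorm f q volume ≤ eLpNorm (φ k) q volume + eLpNorm (φ k - ⇑f) q volume := by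
      have := eLpNorm_sub_le (hφL k).1 ((hφL k).1.sub hfL.1) hq1
      rwa [sub_sub_cancel] at this
    refine h1.trans ?_
    rw [add_comm]
    gcongr
    refine (hK _ (hφ k).1 (hφ k).2).trans ?_
    gcongr
    have h2 := weakGrad_spec (hasWeakGradient_sub hu.2 (hφ k).1)
    have h3 := (weakGrad_spec hu.2).sub h2
    rw [sub_sub_cancel] at h3
    rw [eLpNorm_congr_ae h3.ae_eq]
    exact (eLpNorm_sub_le (weakGrad_spec hu.2).2.1.aestronglyMeasurable
      h2.2.1.aestronglyMeasurable (by simpa using hp.le)).trans (add_le_add le_rfl le_self_add)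
  have hT := hfl.add (ENNReal.Tendsto.const_mul (a := (K : ℝ≥0∞)) (hlim.const_add
    (eLpNorm (weakGrad u) (ENNReal.ofReal p) volume)) (Or.inr ENNReal.coe_ne_top))
  rw [zero_add, add_zero] at hT
  exact ge_of_tendsto' hT hle

/-! ### The weight generated by a test function. -/

/-- The radial form, with Jacobian `y ^ (N - 1)`. Near zero the Lipschitz bound gives the exponent
`p - 1 - s * p > -1` since `s < 1`; at infinity the uniform bound gives `-1 - s * p < -1` since `s >
0`. -/
lemma integrableOn_min_mul_rpow_div {N : ℕ} {s p : ℝ} (hN : 0 < N) (hs₀ : 0 < s) (hs₁ : s < 1)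
    (hp : 0 < p) (L M : ℝ≥0) :
    IntegrableOn (fun y : ℝ => y ^ (N - 1) • (min (L * y) M ^ p / y ^ ((N : ℝ) + s * p)))
      (Set.Ioi 0) := by
  have hpow : ∀ y : ℝ, 0 < y → y ^ (N - 1) = y ^ ((N : ℝ) - 1) := fun y hy => by
    rw [← Real.rpow_natCast, Nat.cast_sub hN, Nat.cast_one]
  have hm : AEStronglyMeasurable
      (fun y : ℝ => y ^ (N - 1) • (min (L * y) M ^ p / y ^ ((N : ℝ) + s * p))) volume := by
    apply Measurable.aestronglyMeasurable
    fun_prop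
  have hmin : ∀ y : ℝ, 0 < y → 0 ≤ min (L * y) (M : ℝ) := fun y hy =>
    le_min (by positivity) M.coe_nonneg
  rw [← Set.Ioc_union_Ioi_eq_Ioi zero_le_one]
  refine IntegrableOn.union ?_ ?_
  · have h1 : IntegrableOn (fun y : ℝ => (L : ℝ) ^ p * y ^ (p - 1 - s * p)) (Set.Ioc 0 1) := by
      refine Integrable.const_mul ?_ _
      rw [← IntegrableOn, ← intervalIntegrable_iff_integrableOn_Ioc_of_le zero_le_one]
      exact intervalIntegral.intervalIntegrable_rpow' (by nlinarith)
    refine h1.mono' hm.restrict ?_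
    filter_upwards [ae_restrict_mem measurableSet_Ioc] with y hy
    have hy0 : 0 < y := hy.1
    have hb := Real.rpow_nonneg (hmin y hy0) p
    rw [smul_eq_mul, Real.norm_of_nonneg (by positivity), hpow y hy0]
    calc _ ≤ y ^ ((N : ℝ) - 1) * ((L * y) ^ p / y ^ ((N : ℝ) + s * p)) := by
          have := hmin y hy0
          gcongr
          exact min_le_left _ _
      _ = (L : ℝ) ^ p * (y ^ ((N : ℝ) - 1) * y ^ p / y ^ ((N : ℝ) + s * p)) := by
          rw [Real.mul_rpow L.coe_nonneg hy0.le]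
          ring
      _ = _ := by
          rw [← Real.rpow_add hy0, ← Real.rpow_sub hy0]
          congr 2
          ring
  · have h1 : IntegrableOn (fun y : ℝ => (M : ℝ) ^ p * y ^ (-1 - s * p)) (Set.Ioi 1) := by
      refine Integrable.const_mul ?_ _
      exact integrableOn_Ioi_rpow_of_lt (by nlinarith [mul_pos hs₀ hp]) zero_lt_one
    refine h1.mono' hm.restrict ?_
    filter_upwards [ae_restrict_mem measurableSet_Ioi] with y hy
    have hy0 : 0 < y := zero_lt_one.trans hy
    have hb := Real.rpow_nonneg (hmin y hy0) p
    rw [smul_eq_mul, Real.norm_of_nonneg (by positivity), hpow y hy0]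
    calc _ ≤ y ^ ((N : ℝ) - 1) * ((M : ℝ) ^ p / y ^ ((N : ℝ) + s * p)) := by
          have := hmin y hy0
          gcongr
          exact min_le_right _ _
      _ = (M : ℝ) ^ p * (y ^ ((N : ℝ) - 1) / y ^ ((N : ℝ) + s * p)) := by
          ring
      _ = _ := by
          rw [← Real.rpow_sub hy0]
          congr 2
          ring

lemma lintegral_min_mul_rpow_div_ne_top {N : ℕ} {s p : ℝ} (hN : 0 < N) (hs₀ : 0 < s) (hs₁ : s < 1)
    (hp : 0 < p) (L M : ℝ≥0) :
    ∫⁻ h : E N, min (L * ‖h‖ₑ) M ^ p / ‖h‖ₑ ^ ((N : ℝ) + s * p) ≠ ⊤ := by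
  have : Nonempty (Fin N) := ⟨⟨0, hN⟩⟩
  have h1 := (integrable_fun_norm_addHaar (volume : Measure (E N))
    (f := fun y : ℝ => min (L * y) M ^ p / y ^ ((N : ℝ) + s * p))).2 (by
      simpa only [finrank_euclideanSpace_fin] using
        integrableOn_min_mul_rpow_div hN hs₀ hs₁ hp L M)
  refine ne_top_of_le_ne_top h1.lintegral_lt_top.ne (lintegral_mono_ae ?_)
  have h0 : ∀ᵐ h : E N, h ≠ 0 := by simp [ae_iff]
  filter_upwards [h0] with h hh
  have hn : 0 < ‖h‖ := norm_pos_iff.2 hh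
  have hmin : 0 ≤ min (L * ‖h‖) (M : ℝ) := le_min (by positivity) M.coe_nonneg
  rw [ENNReal.ofReal_div_of_pos (by positivity), ← ENNReal.ofReal_rpow_of_pos hn,
    ← ENNReal.ofReal_rpow_of_nonneg hmin hp.le, ENNReal.ofReal_min,
    ENNReal.ofReal_mul L.coe_nonneg, ofReal_norm, ENNReal.ofReal_coe_nnreal,
    ENNReal.ofReal_coe_nnreal]

lemma exists_enorm_sub_le_min {N : ℕ} {φ : E N → ℝ} (hφ : ContDiff ℝ ∞ φ)
    (hc : HasCompactSupport φ) : ∃ L M : ℝ≥0, ∀ x h : E N,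
      ‖φ (x + h) - φ x‖ₑ ≤ min (L * ‖h‖ₑ) M := by
  obtain ⟨L, hL⟩ := hφ.lipschitzWith_of_hasCompactSupport hc (by simp)
  obtain ⟨C, hC⟩ := hc.exists_bound_of_continuous hφ.continuous
  refine ⟨L, (C + C).toNNReal, fun x h => le_min ?_ ?_⟩
  · have := hL (x + h) x
    rwa [edist_eq_enorm_sub, edist_eq_enorm_sub, add_sub_cancel_left] at this
  · rw [← ofReal_norm]
    exact ENNReal.ofReal_le_ofReal ((norm_sub_le _ _).trans (add_le_add (hC _) (hC _)))

/-- The fractional derivative of a test function is bounded and integrable. -/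
lemma fracDeriv_contDiff_bounds {N : ℕ} {s p : ℝ} (hN : 0 < N) (hs₀ : 0 < s) (hs₁ : s < 1)
    (hp : 0 < p) {φ : E N → ℝ} (hφ : ContDiff ℝ ∞ φ) (hc : HasCompactSupport φ) :
    (∃ C : ℝ≥0, ∀ x, fracDeriv s p φ x ≤ C) ∧ ∫⁻ x, fracDeriv s p φ x ≠ ⊤ := by
  obtain ⟨L, M, hLM⟩ := exists_enorm_sub_le_min hφ hc
  have hI := lintegral_min_mul_rpow_div_ne_top hN hs₀ hs₁ hp L M
  set A : E N → ℝ≥0∞ := fun h => min (L * ‖h‖ₑ) M ^ p / ‖h‖ₑ ^ ((N : ℝ) + s * p) with hA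
  have hAm : Measurable A := by fun_prop
  have hle : ∀ x h, ‖φ (x + h) - φ x‖ₑ ^ p / ‖h‖ₑ ^ ((N : ℝ) + s * p) ≤ A h := fun x h => by
    exact ENNReal.div_le_div_right (ENNReal.rpow_le_rpow (hLM x h) hp.le) _
  refine ⟨⟨(∫⁻ h, A h).toNNReal, fun x => ?_⟩, ?_⟩
  · rw [ENNReal.coe_toNNReal hI]
    exact lintegral_mono fun h => hle x h
  set K := tsupport φ
  have hK : MeasurableSet K := (isClosed_tsupport φ).measurableSet
  have hKfin : volume K ≠ ⊤ := hc.isCompact.measure_ne_top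
  set χ : E N → ℝ≥0∞ := K.indicator 1 with hχ
  have hχm : Measurable χ := measurable_one.indicator hK
  -- The difference vanishes unless `x` or `x + h` lies in the support. Recording this makes the
  -- bound integrable in `x`, each indicator contributing `volume K` by translation invariance.
  have hle2 : ∀ x h, ‖φ (x + h) - φ x‖ₑ ^ p / ‖h‖ₑ ^ ((N : ℝ) + s * p) ≤
      A h * (χ x + χ (x + h)) := fun x h => by
    by_cases h1 : x ∈ K
    · refine (hle x h).trans (le_mul_of_one_le_right' ?_)
      simp [hχ, h1]
    by_cases h2 : x + h ∈ K
    · refine (hle x h).trans (le_mul_of_one_le_right' ?_)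
      simp [hχ, h2]
    · simp [image_eq_zero_of_notMem_tsupport h1, image_eq_zero_of_notMem_tsupport h2, hp]
  have hm2 : Measurable fun z : E N × E N => A z.2 * (χ z.1 + χ (z.1 + z.2)) := by fun_prop
  have hχi : ∫⁻ x, χ x = volume K := by rw [hχ, lintegral_indicator_one hK]
  have key : ∫⁻ x, fracDeriv s p φ x ≤ (∫⁻ h, A h) * (volume K + volume K) := calc
    _ ≤ ∫⁻ x, ∫⁻ h, A h * (χ x + χ (x + h)) :=
        lintegral_mono fun x => lintegral_mono fun h => hle2 x h
    _ = ∫⁻ h, ∫⁻ x, A h * (χ x + χ (x + h)) := lintegral_lintegral_swap hm2.aemeasurable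
    _ = ∫⁻ h, A h * (volume K + volume K) := by
        refine lintegral_congr fun h => ?_
        rw [lintegral_const_mul _ (by fun_prop), lintegral_add_left hχm,
          lintegral_add_right_eq_self χ h, hχi]
    _ = _ := lintegral_mul_const _ hAm
  exact ne_top_of_le_ne_top (by finiteness) key

lemma gagliardo_contDiff_lt_top {N : ℕ} {s p : ℝ} (hN : 0 < N) (hs₀ : 0 < s) (hs₁ : s < 1)
    (hp : 0 < p) {φ : E N → ℝ} (hφ : ContDiff ℝ ∞ φ) (hc : HasCompactSupport φ) :
    gagliardo s p φ < ⊤ := by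
  have h := (fracDeriv_contDiff_bounds hN hs₀ hs₁ hp hφ hc).2
  rw [lintegral_fracDeriv hp hφ.continuous.aestronglyMeasurable] at h
  rw [lt_top_iff_ne_top]
  rintro h'
  simp [h', hp] at h

/-- The weight `|∇φ|^p + |D^s φ|^p` of a test function is bounded and integrable. -/
lemma weight_contDiff_bounds {N : ℕ} {s p : ℝ} (hN : 0 < N) (hs₀ : 0 < s) (hs₁ : s < 1)
    (hp : 0 < p) {φ : E N → ℝ} (hφ : ContDiff ℝ ∞ φ) (hc : HasCompactSupport φ) :
    AEMeasurable (fun x => ‖gradient φ x‖ₑ ^ p + fracDeriv s p φ x) volume ∧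
    (∃ C : ℝ≥0, ∀ x, ‖gradient φ x‖ₑ ^ p + fracDeriv s p φ x ≤ C) ∧
      ∫⁻ x, ‖gradient φ x‖ₑ ^ p + fracDeriv s p φ x ≠ ⊤ := by
  obtain ⟨⟨C, hC⟩, hi⟩ := fracDeriv_contDiff_bounds (s := s) hN hs₀ hs₁ hp hφ hc
  have hg := continuous_gradient hφ
  have hgm : Measurable fun x => ‖gradient φ x‖ₑ ^ p := by
    have := hg.measurable
    fun_prop
  refine ⟨hgm.aemeasurable.add (aemeasurable_fracDeriv hp hφ.continuous.aestronglyMeasurable),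
    ?_, ?_⟩
  · obtain ⟨B, hB⟩ := (hasCompactSupport_gradient hc).exists_bound_of_continuous hg
    refine ⟨B.toNNReal ^ p + C, fun x => ?_⟩
    rw [ENNReal.coe_add, ENNReal.coe_rpow_of_nonneg _ hp.le]
    gcongr
    · rw [← ofReal_norm]
      exact ENNReal.ofReal_le_ofReal (hB x)
    · exact hC x
  · rw [lintegral_add_left hgm]
    refine ENNReal.add_ne_top.2 ⟨?_, hi⟩
    have h1 : MemLp (gradient φ) (ENNReal.ofReal p) volume :=
      hg.memLp_of_hasCompactSupport (hasCompactSupport_gradient hc)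
    rw [← eLpNorm_ofReal_rpow hp]
    exact ENNReal.rpow_ne_top_of_nonneg hp.le h1.2.ne

/-- From `g ^ r ≤ C ^ (r - 1) * g`. It supplies the power `N / p` of the weight that Hölder's
inequality calls for. -/
lemma lintegral_rpow_ne_top_of_bounded {α : Type*} [MeasurableSpace α] {μ : Measure α}
    {g : α → ℝ≥0∞} {C : ℝ≥0} (hC : ∀ x, g x ≤ C) (hg : ∫⁻ x, g x ∂μ ≠ ⊤) {r : ℝ} (hr : 1 ≤ r) :
    ∫⁻ x, g x ^ r ∂μ ≠ ⊤ := by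
  have h : ∫⁻ x, g x ^ r ∂μ ≤ ∫⁻ x, (C : ℝ≥0∞) ^ (r - 1) * g x ∂μ := by
    refine lintegral_mono fun x => ?_
    calc g x ^ r = g x ^ (r - 1) * g x := by
          nth_rw 3 [← ENNReal.rpow_one (g x)]
          rw [← ENNReal.rpow_add_of_nonneg _ _ (by linarith) zero_le_one, sub_add_cancel]
      _ ≤ _ := by
          have : 0 ≤ r - 1 := by linarith
          gcongr
          exact hC x
  rw [lintegral_const_mul' _ _ (ENNReal.rpow_ne_top_of_nonneg (by linarith) (by simp))] at h
  exact ne_top_of_le_ne_top (ENNReal.mul_ne_top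
    (ENNReal.rpow_ne_top_of_nonneg (by linarith) (by simp)) hg) h

/-! ### Multiplication by test functions on `𝒲_p`. -/

/-- Hölder's inequality with the conjugate exponents `p^*/p` and `N/p`. -/
lemma lintegral_rpow_mul_le {N : ℕ} {p : ℝ} (hp : 1 < p) (hpN : p < N) {w : E N → ℝ}
    (hw : AEStronglyMeasurable w volume) {g : E N → ℝ≥0∞} (hg : AEMeasurable g volume) :
    ∫⁻ x, ‖w x‖ₑ ^ p * g x ≤ eLpNorm w (ENNReal.ofReal (pStar N p)) volume ^ p *
      (∫⁻ x, g x ^ (N / p)) ^ (p / N) := by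
  have hp0 : 0 < p := by linarith
  have hq0 := pStar_pos hp hpN
  have hN0 : (0 : ℝ) < N := by linarith
  have hNp : (N : ℝ) - p ≠ 0 := by linarith
  have hconj : (pStar N p / p).HolderConjugate (N / p) := by
    rw [Real.holderConjugate_iff]
    refine ⟨(one_lt_div hp0).2 (lt_pStar hp hpN), ?_⟩
    rw [pStar]
    field_simp
    ring
  have h := ENNReal.lintegral_mul_le_Lp_mul_Lq volume hconj (hw.enorm.pow_const p) hg
  simp only [Pi.mul_apply, ← ENNReal.rpow_mul, mul_div_cancel₀ _ hp0.ne', one_div_div] at h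
  refine h.trans_eq ?_
  rw [eLpNorm_ofReal_eq hq0, ← ENNReal.rpow_mul, one_div_mul_eq_div]

lemma rho_zero {N : ℕ} {s p : ℝ} (hp : 1 ≤ p) : rho s p (0 : E N → ℝ) = 0 := by
  have := rho_smul (s := s) hp 0 (MemW.zero (N := N) (s := s) hp).2
  simpa using this

lemma eLpNorm_weakGrad_lt_top_of_contDiff {N : ℕ} {φ : E N → ℝ} (hφ : ContDiff ℝ ∞ φ)
    (hc : HasCompactSupport φ) (r : ℝ≥0∞) : eLpNorm (weakGrad φ) r volume < ⊤ := by
  rw [eLpNorm_weakGrad_of_contDiff hφ]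
  exact ((hφ.continuous_fderiv (by simp)).memLp_of_hasCompactSupport (hc.fderiv ℝ)).2

lemma MemW.of_contDiff {N : ℕ} {s p : ℝ} (hN : 0 < N) (hs₀ : 0 < s) (hs₁ : s < 1) (hp : 1 ≤ p)
    {φ : E N → ℝ} (hφ : ContDiff ℝ ∞ φ) (hc : HasCompactSupport φ) : MemW s p φ := by
  refine ⟨hφ.continuous.memLp_of_hasCompactSupport hc, ⟨_, .of_contDiff hφ⟩,
    ENNReal.add_lt_top.2 ⟨eLpNorm_weakGrad_lt_top_of_contDiff hφ hc _,
      gagliardo_contDiff_lt_top hN hs₀ hs₁ (by linarith) hφ hc⟩,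
    fun _ => φ, fun _ => ⟨hφ, hc⟩, ?_⟩
  simp [rho_zero hp]

lemma MemW.sub {N : ℕ} {s p : ℝ} (hp : 1 ≤ p) {u v : E N → ℝ} (hu : MemW s p u)
    (hv : MemW s p v) : MemW s p (u - v) := by
  have := hu.add hp (hv.smul hp (-1))
  simpa [sub_eq_add_neg] using this

lemma rho_sub_le {N : ℕ} {s p : ℝ} (hp : 1 ≤ p) {u v : E N → ℝ}
    (hu : MemW s p u) (hv : MemW s p v) : rho s p (u - v) ≤ rho s p u + rho s p v := by
  have := rho_add_le (s := s) hp hu.2 (hv.smul hp (-1)).2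
  rw [rho_smul hp _ hv.2] at this
  simpa [sub_eq_add_neg] using this

lemma energyMeasure_univ_rpow_le {N : ℕ} {s p : ℝ} (hp : 1 ≤ p) {u : E N → ℝ}
    (hu : ∃ G, IsWeakGradient u G) : energyMeasure s p u Set.univ ^ (1 / p) ≤ rho s p u := by
  rw [energyMeasure_univ (by linarith) hu]
  exact ENNReal.rpow_add_rpow_le_add _ _ hp

lemma MemW.isFiniteMeasure_energyMeasure {N : ℕ} {s p : ℝ} (hp : 1 ≤ p) {u : E N → ℝ}
    (hu : MemW s p u) : IsFiniteMeasure (energyMeasure s p u) := by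
  have hp0 : 0 < p := by linarith
  refine ⟨?_⟩
  rw [energyMeasure_univ hp0 hu.2]
  have := ENNReal.add_lt_top.1 hu.3
  exact ENNReal.add_lt_top.2 ⟨ENNReal.rpow_lt_top_of_nonneg hp0.le this.1.ne,
    ENNReal.rpow_lt_top_of_nonneg hp0.le this.2.ne⟩

lemma rho_le_two_mul {N : ℕ} {s p : ℝ} (hp : 0 < p) (u : E N → ℝ) :
    rho s p u ≤ 2 * (eLpNorm (weakGrad u) (ENNReal.ofReal p) volume ^ p +
      gagliardo s p u ^ p) ^ (1 / p) := by
  have h : ∀ a b : ℝ≥0∞, a ≤ (a ^ p + b ^ p) ^ (1 / p) := fun a b => by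
    conv_lhs => rw [← rpow_rpow_one_div hp a]
    gcongr
    exact le_self_add
  rw [two_mul, rho]
  refine add_le_add (h _ _) ?_
  rw [add_comm (_ ^ p)]
  exact h _ _

/-- Multiplication by a test function is bounded on `𝒲_p`. -/
lemma exists_rho_mul_le {N : ℕ} {s p : ℝ} (hs₀ : 0 < s) (hs₁ : s < 1) (hp : 1 < p) (hpN : p < N)
    {φ : E N → ℝ} (hφ : ContDiff ℝ ∞ φ) (hc : HasCompactSupport φ) :
    ∃ C : ℝ≥0∞, C ≠ ⊤ ∧ ∀ w : E N → ℝ, MemW s p w →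
      rho s p (fun x => φ x * w x) ≤ C * rho s p w := by
  have hp0 : 0 < p := by linarith
  have hN0 : (0 : ℝ) < N := by linarith
  have hN : 0 < N := by exact_mod_cast hN0
  obtain ⟨K, hK⟩ := exists_sobolev (N := N) hs₀ hp hpN
  obtain ⟨B, hB⟩ := hc.exists_bound_of_continuous hφ.continuous
  obtain ⟨hgm, ⟨C, hC⟩, hgi⟩ := weight_contDiff_bounds hN hs₀ hs₁ hp0 hφ hc
  set g := fun x => ‖gradient φ x‖ₑ ^ p + fracDeriv s p φ x
  have hgr := lintegral_rpow_ne_top_of_bounded hC hgi (r := N / p) ((one_le_div hp0).2 hpN.le)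
  set I := (∫⁻ x, g x ^ (N / p)) ^ (p / N)
  have hI : I ≠ ⊤ := ENNReal.rpow_ne_top_of_nonneg (by positivity) hgr
  have hI' : I ^ (1 / p) ≠ ⊤ := ENNReal.rpow_ne_top_of_nonneg (by positivity) hI
  -- The bound `B` of `φ` serves the energy term, Sobolev's constant `K` times the Hölder factor
  -- serves the commutator, and `2` passes from the `ℓ^p`-sum of the two seminorms to `rho`.
  refine ⟨2 * (ENNReal.ofReal B + K * I ^ (1 / p)), by finiteness, fun w hw => ?_⟩
  refine (rho_le_two_mul hp0 _).trans ?_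
  rw [mul_assoc]
  gcongr
  refine (energy_mul_le hp.le hw.2 hφ hc).trans ?_
  rw [add_mul]
  gcongr ?_ + ?_
  · calc _ ≤ (∫⁻ _, ENNReal.ofReal B ^ p ∂(energyMeasure s p w)) ^ (1 / p) := by
          gcongr with x
          rw [← ofReal_norm]
          exact ENNReal.ofReal_le_ofReal (hB x)
      _ = ENNReal.ofReal B * energyMeasure s p w Set.univ ^ (1 / p) := by
          rw [lintegral_const, ENNReal.mul_rpow_of_nonneg _ _ (by positivity),
            rpow_rpow_one_div hp0]
      _ ≤ _ := by
          gcongr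
          exact energyMeasure_univ_rpow_le hp.le hw.2
  · calc _ ≤ (eLpNorm w (ENNReal.ofReal (pStar N p)) volume ^ p * I) ^ (1 / p) := by
          gcongr
          exact lintegral_rpow_mul_le hp hpN hw.memLp.1 hgm
      _ = eLpNorm w (ENNReal.ofReal (pStar N p)) volume * I ^ (1 / p) := by
          rw [ENNReal.mul_rpow_of_nonneg _ _ (by positivity), rpow_rpow_one_div hp0]
      _ ≤ (K * rho s p w) * I ^ (1 / p) := by
          gcongr
          exact (hK w hw).trans (by gcongr; exact le_self_add)
      _ = _ := by ring

/-- Multiplication is `ρ_p`-bounded, so it carries approximants to approximants. Localized functions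
are therefore admissible in the inequality defining the best constant. -/
lemma MemW.mul_contDiff {N : ℕ} {s p : ℝ} (hs₀ : 0 < s) (hs₁ : s < 1) (hp : 1 < p) (hpN : p < N)
    {φ : E N → ℝ} (hφ : ContDiff ℝ ∞ φ) (hc : HasCompactSupport φ) {u : E N → ℝ}
    (hu : MemW s p u) : MemW s p (fun x => φ x * u x) := by
  have hN0 : (0 : ℝ) < N := by linarith
  have hN : 0 < N := by exact_mod_cast hN0
  obtain ⟨C, hC, hle⟩ := exists_rho_mul_le (s := s) hs₀ hs₁ hp hpN hφ hc
  obtain ⟨B, hB⟩ := hc.exists_bound_of_continuous hφ.continuous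
  refine ⟨?_, ⟨_, (weakGrad_spec hu.2).mul_contDiff hφ hc⟩,
    (hle u hu).trans_lt (ENNReal.mul_lt_top hC.lt_top hu.3), ?_⟩
  · refine MemLp.of_le_mul (c := B) hu.memLp
      (hφ.continuous.aestronglyMeasurable.mul hu.memLp.1) (Eventually.of_forall fun x => ?_)
    rw [norm_mul]
    gcongr
    exact hB x
  · obtain ⟨ψ, hψ, hlim⟩ := hu.approx
    refine ⟨fun k x => φ x * ψ k x, fun k => ⟨hφ.mul (hψ k).1, hc.mul_right⟩, ?_⟩
    have h0 := ENNReal.Tendsto.const_mul hlim (Or.inr hC)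
    rw [mul_zero] at h0
    refine tendsto_of_tendsto_of_tendsto_of_le_of_le tendsto_const_nhds h0 (fun _ => zero_le)
      fun k => ?_
    have := hle (u - ψ k) (hu.sub hp.le (.of_contDiff hN hs₀ hs₁ hp.le (hψ k).1 (hψ k).2))
    have he : (fun x => φ x * u x) - (fun x => φ x * ψ k x) = fun x => φ x * (u - ψ k) x := by
      ext x
      simp [mul_sub]
    rwa [← he] at this

/-! ### Ball averages and local strong convergence. -/

/-- The average of `w` over the ball of radius `r` around `x`. -/
def ballAvg {N : ℕ} (r : ℝ) (w : E N → ℝ) (x : E N) : ℝ :=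
  (volume.real (Metric.ball x r))⁻¹ * ∫ y in Metric.ball x r, w y

lemma LocallyIntegrable.integrableOn_ball {N : ℕ} {w : E N → ℝ} (hw : LocallyIntegrable w volume)
    (x : E N) (r : ℝ) : IntegrableOn w (Metric.ball x r) volume :=
  (hw.integrableOn_isCompact (isCompact_closedBall x r)).mono_set Metric.ball_subset_closedBall

lemma aestronglyMeasurable_ballAvg {N : ℕ} (r : ℝ) {w : E N → ℝ}
    (hw : AEStronglyMeasurable w volume) : AEStronglyMeasurable (ballAvg r w) volume := by
  have h1 : AEStronglyMeasurable (fun x : E N => ∫ y, Set.indicator {z : E N × E N |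
      dist z.2 z.1 < r} (fun z => w z.2) (x, y)) volume := by
    refine AEStronglyMeasurable.integral_prod_right' (f := Set.indicator {z : E N × E N |
      dist z.2 z.1 < r} (fun z => w z.2)) (hw.comp_snd.indicator ?_)
    exact measurableSet_lt (by fun_prop) measurable_const
  have h2 : ballAvg r w = fun x => (volume.real (Metric.ball (0 : E N) r))⁻¹ *
      ∫ y, Set.indicator {z : E N × E N | dist z.2 z.1 < r} (fun z => w z.2) (x, y) := by
    ext x
    rw [ballAvg, measureReal_def, measureReal_def, Measure.addHaar_ball_center,
      ← integral_indicator Metric.isOpen_ball.measurableSet]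
    rfl
  rw [h2]
  exact h1.const_mul _

lemma volume_ball_ne_zero {N : ℕ} (x : E N) {r : ℝ} (hr : 0 < r) :
    volume (Metric.ball x r) ≠ 0 := (Metric.measure_ball_pos _ _ hr).ne'

lemma enorm_inv_volume_ball {N : ℕ} (x : E N) {r : ℝ} (hr : 0 < r) :
    ‖(volume.real (Metric.ball x r))⁻¹‖ₑ = (volume (Metric.ball x r))⁻¹ := by
  have h0 : 0 < volume.real (Metric.ball x r) :=
    ENNReal.toReal_pos (volume_ball_ne_zero x hr) measure_ball_lt_top.ne
  rw [Real.enorm_of_nonneg (by positivity), ENNReal.ofReal_inv_of_pos h0, measureReal_def,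
    ENNReal.ofReal_toReal measure_ball_lt_top.ne]

lemma enorm_setIntegral_ball_le {N : ℕ} (x : E N) (r : ℝ) {q : ℝ} (hq : 1 ≤ q) {w : E N → ℝ}
    (hw : AEStronglyMeasurable w volume) : ‖∫ y in Metric.ball x r, w y‖ₑ ≤
      (∫⁻ y in Metric.ball x r, ‖w y‖ₑ ^ q) ^ (1 / q) *
        volume (Metric.ball x r) ^ (1 - 1 / q) := by
  have h := eLpNorm_le_eLpNorm_mul_rpow_measure_univ (μ := volume.restrict (Metric.ball x r))
    (p := 1) (q := ENNReal.ofReal q) (by simpa using hq) hw.restrict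
  rw [eLpNorm_one_eq_lintegral_enorm, eLpNorm_ofReal_eq (by linarith), ENNReal.toReal_one,
    ENNReal.toReal_ofReal (by linarith), Measure.restrict_apply_univ, div_one] at h
  exact (enorm_integral_le_lintegral_enorm _).trans h

/-- Ball averages approximate `w`, with an error controlled by the fractional derivative. -/
lemma enorm_sub_ballAvg_rpow_le {N : ℕ} {s p : ℝ} (hs : 0 < s) (hp : 1 ≤ p) {w : E N → ℝ}
    (hw : LocallyIntegrable w volume) {r : ℝ} (hr : 0 < r) (x : E N) :
    ‖w x - ballAvg r w x‖ₑ ^ p ≤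
      ENNReal.ofReal (r ^ (s * p)) * (volume (Metric.ball (0 : E N) 1))⁻¹ *
        fracDeriv s p w x := by
  have hp0 : 0 < p := by linarith
  have hv0 := volume_ball_ne_zero x hr
  have hvt : volume (Metric.ball x r) ≠ ⊤ := measure_ball_lt_top.ne
  set V := volume (Metric.ball x r) with hV
  have hwm := hw.aestronglyMeasurable
  have h1 : w x - ballAvg r w x =
      (volume.real (Metric.ball x r))⁻¹ * ∫ y in Metric.ball x r, (w x - w y) := by
    have hreal : volume.real (Metric.ball x r) ≠ 0 := (ENNReal.toReal_pos hv0 hvt).ne'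
    have hci : IntegrableOn (fun _ => w x) (Metric.ball x r) volume := integrableOn_const hvt
    rw [integral_sub hci.integrable (LocallyIntegrable.integrableOn_ball hw x r),
      setIntegral_const, smul_eq_mul, mul_sub, inv_mul_cancel_left₀ hreal, ballAvg]
  -- Jensen's inequality, obtained from Hölder: the volume factors combine to `V ^ (-p) * V ^ (p -
  -- 1) = V⁻¹`.
  have h2 : ‖w x - ballAvg r w x‖ₑ ^ p ≤ V⁻¹ * ∫⁻ y in Metric.ball x r, ‖w x - w y‖ₑ ^ p := by
    rw [h1, enorm_mul, enorm_inv_volume_ball x hr, ENNReal.mul_rpow_of_nonneg _ _ hp0.le]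
    calc _ ≤ V⁻¹ ^ p * ((∫⁻ y in Metric.ball x r, ‖w x - w y‖ₑ ^ p) ^ (1 / p) *
          V ^ (1 - 1 / p)) ^ p := by
          gcongr
          exact enorm_setIntegral_ball_le x r hp (aestronglyMeasurable_const.sub hwm)
      _ = (V ^ (-p) * V ^ (p - 1)) * ∫⁻ y in Metric.ball x r, ‖w x - w y‖ₑ ^ p := by
          rw [ENNReal.mul_rpow_of_nonneg _ _ hp0.le, rpow_one_div_rpow hp0, ← ENNReal.rpow_mul,
            ENNReal.inv_rpow, ENNReal.rpow_neg, sub_mul, one_div_mul_cancel hp0.ne', one_mul]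
          ring
      _ = _ := by
          rw [← ENNReal.rpow_add _ _ hv0 hvt, show -p + (p - 1) = -1 by ring, ENNReal.rpow_neg_one]
  have h3 : ∫⁻ y in Metric.ball x r, ‖w x - w y‖ₑ ^ p ≤
      ENNReal.ofReal (r ^ ((N : ℝ) + s * p)) * fracDeriv s p w x := by
    rw [fracDeriv_eq hp0, ← lintegral_const_mul' _ _ ENNReal.ofReal_ne_top]
    refine le_trans (setLIntegral_mono' Metric.isOpen_ball.measurableSet fun y hy => ?_)
      (setLIntegral_le_lintegral (Metric.ball x r) _)
    rw [diffQuot_rpow hp0]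
    by_cases hxy : x = y
    · simp [hxy, hp0]
    have hn : ‖x - y‖ₑ ≠ 0 := by simpa [sub_eq_zero] using hxy
    have hle : ‖x - y‖ₑ ^ ((N : ℝ) + s * p) ≤ ENNReal.ofReal (r ^ ((N : ℝ) + s * p)) := by
      rw [← ENNReal.ofReal_rpow_of_pos hr, ← ofReal_norm]
      gcongr
      rw [← dist_eq_norm, dist_comm]
      exact (Metric.mem_ball.1 hy).le
    calc ‖w x - w y‖ₑ ^ p = ‖x - y‖ₑ ^ ((N : ℝ) + s * p) *
          (‖w x - w y‖ₑ ^ p / ‖x - y‖ₑ ^ ((N : ℝ) + s * p)) := by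
          rw [ENNReal.mul_div_cancel]
          · simp [ENNReal.rpow_eq_zero_iff, hn]
          · exact ENNReal.rpow_ne_top_of_nonneg (by positivity) enorm_ne_top
      _ ≤ _ := by gcongr
  refine (h2.trans (mul_le_mul_right h3 _)).trans_eq ?_
  -- The volume of the ball scales like `r ^ N`, which cancels against `r ^ (N + s * p)` and leaves
  -- the small factor `r ^ (s * p)`.
  rw [hV, Measure.addHaar_ball_of_pos _ _ hr, finrank_euclideanSpace_fin, ← mul_assoc]
  congr 1
  have hrN : 0 < r ^ N := pow_pos hr N
  rw [ENNReal.mul_inv (Or.inl (by simpa using hrN)) (Or.inl ENNReal.ofReal_ne_top),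
    ← ENNReal.ofReal_inv_of_pos hrN, mul_right_comm, ← ENNReal.ofReal_mul (by positivity),
    Real.rpow_add hr, Real.rpow_natCast, inv_mul_cancel_left₀ hrN.ne']

lemma WeaklyTendsto.sub_const {N : ℕ} {s p : ℝ} {hp : 1 ≤ p} {u : ℕ → W N s p hp}
    {u₀ : W N s p hp} (h : WeaklyTendsto u u₀) : WeaklyTendsto (fun n => u n - u₀) 0 := by
  intro F hF
  have := (h F hF).sub_const (F u₀)
  simpa using this

lemma IsBoundedSeq.sub_const {N : ℕ} {s p : ℝ} {hp : 1 ≤ p} {u : ℕ → W N s p hp}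
    (h : IsBoundedSeq u) (u₀ : W N s p hp) : IsBoundedSeq (fun n => u n - u₀) := by
  obtain ⟨C, hC⟩ := h
  refine ⟨C + (rho s p (u₀ : E N → ℝ)).toNNReal, fun n => ?_⟩
  rw [ENNReal.coe_add, ENNReal.coe_toNNReal (MemW.rho_lt_top u₀.2).ne]
  exact (rho_sub_le hp (u n).2 u₀.2).trans (by gcongr; exact hC n)

/-- Bounded sets of `𝒲_p` have uniformly bounded integrals over balls of a given radius. -/
lemma exists_enorm_setIntegral_ball_le {N : ℕ} {s p : ℝ} (hs : 0 < s) (hp : 1 < p) (hpN : p < N)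
    (r : ℝ) : ∃ C : ℝ≥0, ∀ (w : E N → ℝ), MemW s p w → ∀ x,
      ‖∫ y in Metric.ball x r, w y‖ₑ ≤ C * rho s p w := by
  obtain ⟨K, hK⟩ := exists_sobolev (N := N) hs hp hpN
  have hq1 := one_le_pStar hp hpN
  have hq0 := pStar_pos hp hpN
  have hV : volume (Metric.ball (0 : E N) r) ^ (1 - 1 / pStar N p) ≠ ⊤ :=
    ENNReal.rpow_ne_top_of_nonneg (sub_nonneg.2 ((div_le_one hq0).2 hq1)) measure_ball_lt_top.ne
  refine ⟨K * (volume (Metric.ball (0 : E N) r) ^ (1 - 1 / pStar N p)).toNNReal,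
    fun w hw x => (enorm_setIntegral_ball_le x r hq1 hw.memLp.1).trans ?_⟩
  rw [ENNReal.coe_mul, ENNReal.coe_toNNReal hV, Measure.addHaar_ball_center, mul_right_comm]
  gcongr
  refine le_trans ?_ ((hK w hw).trans (by gcongr; exact le_self_add))
  rw [eLpNorm_ofReal_eq hq0]
  gcongr
  exact Measure.restrict_le_self

/-- Integration over a ball is a linear functional continuous for `ρ_p`, by Hölder and Sobolev, so
weak convergence applies to it. -/
lemma tendsto_ballAvg {N : ℕ} {s p : ℝ} (hs : 0 < s) (hp : 1 < p) (hpN : p < N) (r : ℝ)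
    {w : ℕ → W N s p hp.le} (hw : WeaklyTendsto w 0) (x : E N) :
    Tendsto (fun n => ballAvg r (w n : E N → ℝ) x) atTop (𝓝 0) := by
  obtain ⟨C, hC⟩ := exists_enorm_setIntegral_ball_le (N := N) hs hp hpN r
  have hint : ∀ v : W N s p hp.le, IntegrableOn (v : E N → ℝ) (Metric.ball x r) volume :=
    fun v => LocallyIntegrable.integrableOn_ball (weakGrad_spec (MemW.hasWeakGradient v.2)).1 x r
  let F : W N s p hp.le →ₗ[ℝ] ℝ :=
    { toFun := fun v => ∫ y in Metric.ball x r, (v : E N → ℝ) y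
      map_add' := fun v v' => by
        simpa using integral_add (hint v) (hint v')
      map_smul' := fun c v => by
        simpa using integral_const_mul c _ }
  have h := (hw F ⟨C, fun v => hC v v.2 x⟩).const_mul (volume.real (Metric.ball x r))⁻¹
  rw [map_zero, mul_zero] at h
  exact h

/-- Weakly null bounded sequences of `𝒲_p` tend to zero in `L^p` with respect to bounded integrable
weights. -/
lemma tendsto_lintegral_rpow_mul {N : ℕ} {s p : ℝ} (hs : 0 < s) (hp : 1 < p) (hpN : p < N)
    {w : ℕ → W N s p hp.le} (hb : IsBoundedSeq w) (hw : WeaklyTendsto w 0)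
    {g : E N → ℝ≥0∞} (hg : AEMeasurable g volume) {C : ℝ≥0} (hgC : ∀ x, g x ≤ C)
    (hgi : ∫⁻ x, g x ≠ ⊤) :
    Tendsto (fun n => ∫⁻ x, ‖(w n : E N → ℝ) x‖ₑ ^ p * g x) atTop (𝓝 0) := by
  have hp0 : 0 < p := by linarith
  obtain ⟨M, hM⟩ := hb
  have hwl : ∀ n, LocallyIntegrable (w n : E N → ℝ) volume := fun n =>
    (weakGrad_spec (MemW.hasWeakGradient (w n).2)).1
  set b := (volume (Metric.ball (0 : E N) 1))⁻¹
  have hbt : b ≠ ⊤ := ENNReal.inv_ne_top.2 (volume_ball_ne_zero _ zero_lt_one)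
  -- For fixed `r` the averages are bounded uniformly in `x` and `n`, so a multiple of the
  -- integrable weight `g` dominates.
  have havg : ∀ r : ℝ, 0 < r → Tendsto
      (fun n => ∫⁻ x, ‖ballAvg r (w n : E N → ℝ) x‖ₑ ^ p * g x) atTop (𝓝 0) := by
    intro r hr
    obtain ⟨D, hD⟩ := exists_enorm_setIntegral_ball_le (N := N) hs hp hpN r
    set V := (volume (Metric.ball (0 : E N) r))⁻¹
    have hV : V ≠ ⊤ := ENNReal.inv_ne_top.2 (volume_ball_ne_zero _ hr)
    have hT : ((V * (D * M)) ^ p : ℝ≥0∞) ≠ ⊤ :=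
      ENNReal.rpow_ne_top_of_nonneg hp0.le (by finiteness)
    have h := tendsto_lintegral_of_dominated_convergence' (μ := (volume : Measure (E N)))
      (F := fun n x => ‖ballAvg r (w n : E N → ℝ) x‖ₑ ^ p * g x) (f := fun _ => 0)
      (fun x => (V * (D * M)) ^ p * g x)
      (fun n => ((aestronglyMeasurable_ballAvg r (hwl n).aestronglyMeasurable).enorm.pow_const
        p).mul hg) (fun n => Eventually.of_forall fun x => ?_) ?_
      (Eventually.of_forall fun x => ?_)
    · simpa using h
    · refine mul_le_mul_left (ENNReal.rpow_le_rpow ?_ hp0.le) _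
      rw [ballAvg, enorm_mul, enorm_inv_volume_ball x hr, Measure.addHaar_ball_center]
      gcongr
      exact (hD _ (w n).2 x).trans (by gcongr; exact hM n)
    · rw [lintegral_const_mul' _ _ hT]
      finiteness
    · have h1 := (tendsto_ballAvg hs hp hpN r hw x).enorm
      have h2 := (ENNReal.continuous_rpow_const (y := p)).tendsto _ |>.comp h1
      have h3 := ENNReal.Tendsto.mul_const (b := g x) h2
        (Or.inr (ne_top_of_le_ne_top ENNReal.coe_ne_top (hgC x)))
      simpa [hp0] using h3
  set c : ℝ≥0∞ := 2 ^ (p - 1)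
  have hct : c ≠ ⊤ := ENNReal.rpow_ne_top_of_nonneg (by linarith) (by simp)
  -- The distance to the averages costs `r ^ (s * p)` times the bounded fractional energy, uniformly
  -- in `n`. Thus `n → ∞` is taken first and `r → 0` afterwards.
  have hle : ∀ r : ℝ, 0 < r → ∀ n, ∫⁻ x, ‖(w n : E N → ℝ) x‖ₑ ^ p * g x ≤
      c * (ENNReal.ofReal (r ^ (s * p)) * (b * C * M ^ p) +
        ∫⁻ x, ‖ballAvg r (w n : E N → ℝ) x‖ₑ ^ p * g x) := by
    intro r hr n
    have hpt : ∀ x, ‖(w n : E N → ℝ) x‖ₑ ^ p * g x ≤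
        c * (ENNReal.ofReal (r ^ (s * p)) * b * C * fracDeriv s p (w n : E N → ℝ) x +
          ‖ballAvg r (w n : E N → ℝ) x‖ₑ ^ p * g x) := fun x => by
      have h1 : ‖(w n : E N → ℝ) x‖ₑ ≤ ‖(w n : E N → ℝ) x - ballAvg r (w n : E N → ℝ) x‖ₑ +
          ‖ballAvg r (w n : E N → ℝ) x‖ₑ := by
        simpa using enorm_add_le ((w n : E N → ℝ) x - ballAvg r (w n : E N → ℝ) x)
          (ballAvg r (w n : E N → ℝ) x)
      calc _ ≤ c * (‖(w n : E N → ℝ) x - ballAvg r (w n : E N → ℝ) x‖ₑ ^ p +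
            ‖ballAvg r (w n : E N → ℝ) x‖ₑ ^ p) * g x := by
            gcongr
            exact (ENNReal.rpow_le_rpow h1 hp0.le).trans
              (ENNReal.rpow_add_le_mul_rpow_add_rpow _ _ hp.le)
        _ = c * (‖(w n : E N → ℝ) x - ballAvg r (w n : E N → ℝ) x‖ₑ ^ p * g x +
            ‖ballAvg r (w n : E N → ℝ) x‖ₑ ^ p * g x) := by ring
        _ ≤ _ := by
            refine mul_le_mul_right (add_le_add ?_ le_rfl) _
            rw [mul_right_comm]
            exact mul_le_mul' (enorm_sub_ballAvg_rpow_le hs hp.le (hwl n) hr x) (hgC x)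
    refine (lintegral_mono hpt).trans ?_
    have hfm := aemeasurable_fracDeriv (s := s) hp0 (hwl n).aestronglyMeasurable
    rw [lintegral_const_mul' _ _ hct, lintegral_add_left' (hfm.const_mul _),
      lintegral_const_mul'' _ hfm, lintegral_fracDeriv hp0 (hwl n).aestronglyMeasurable]
    refine mul_le_mul_right (add_le_add ?_ le_rfl) _
    rw [mul_assoc, mul_assoc, ← mul_assoc b]
    exact mul_le_mul_right (mul_le_mul_right
      (ENNReal.rpow_le_rpow (le_add_self.trans (hM n)) hp0.le) _) _
  have hlimsup : ∀ r : ℝ, 0 < r →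
      limsup (fun n => ∫⁻ x, ‖(w n : E N → ℝ) x‖ₑ ^ p * g x) atTop ≤
        c * (ENNReal.ofReal (r ^ (s * p)) * (b * C * M ^ p)) := by
    intro r hr
    have h1 := ENNReal.Tendsto.const_mul (a := c) ((havg r hr).const_add
      (ENNReal.ofReal (r ^ (s * p)) * (b * C * M ^ p))) (Or.inr hct)
    rw [add_zero] at h1
    rw [← h1.limsup_eq]
    exact limsup_le_limsup (Eventually.of_forall (hle r hr))
  have hMp : ((M : ℝ≥0∞) ^ p) ≠ ⊤ := ENNReal.rpow_ne_top_of_nonneg hp0.le (by simp)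
  have hr0 : Tendsto (fun r : ℝ => c * (ENNReal.ofReal (r ^ (s * p)) * (b * C * M ^ p)))
      (𝓝[>] 0) (𝓝 0) := by
    have hsp : 0 < s * p := by positivity
    have h1 : Tendsto (fun r : ℝ => ENNReal.ofReal (r ^ (s * p))) (𝓝[>] 0) (𝓝 0) := by
      have := ((Real.continuousAt_rpow_const 0 (s * p) (Or.inr hsp.le)).tendsto.mono_left
        (nhdsWithin_le_nhds (s := Set.Ioi 0)))
      rw [Real.zero_rpow hsp.ne'] at this
      simpa using ENNReal.tendsto_ofReal this
    have h2 := ENNReal.Tendsto.const_mul (a := c) (ENNReal.Tendsto.mul_const (b := b * C * M ^ p)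
      h1 (Or.inr (by finiteness))) (Or.inr hct)
    simpa using h2
  have hzero : limsup (fun n => ∫⁻ x, ‖(w n : E N → ℝ) x‖ₑ ^ p * g x) atTop ≤ 0 :=
    ge_of_tendsto hr0 (by filter_upwards [self_mem_nhdsWithin] with r hr using hlimsup r hr)
  exact tendsto_of_le_liminf_of_limsup_le zero_le hzero

/-! ### Passage to the limit in the localized Sobolev inequality. -/

lemma WeakStarTendsto.tendsto_lintegral {N : ℕ} {μ : ℕ → Measure (E N)} {μ₀ : Measure (E N)}
    (h : WeakStarTendsto μ μ₀) [∀ n, IsFiniteMeasure (μ n)] [IsFiniteMeasure μ₀] {φ : E N → ℝ}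
    (hφ : Continuous φ) (hc : HasCompactSupport φ) {a : ℝ} (ha : 0 < a) :
    Tendsto (fun n => ∫⁻ x, ‖φ x‖ₑ ^ a ∂(μ n)) atTop (𝓝 (∫⁻ x, ‖φ x‖ₑ ^ a ∂μ₀)) := by
  have hcont : Continuous fun x => ‖φ x‖ ^ a := hφ.norm.rpow_const fun _ => Or.inr ha.le
  have hsupp : HasCompactSupport fun x => ‖φ x‖ ^ a :=
    hc.comp_left (g := fun t : ℝ => ‖t‖ ^ a) (by simp [ha.ne'])
  have key : ∀ (τ : Measure (E N)) [IsFiniteMeasure τ],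
      ENNReal.ofReal (∫ x, ‖φ x‖ ^ a ∂τ) = ∫⁻ x, ‖φ x‖ₑ ^ a ∂τ := fun τ _ => by
    rw [ofReal_integral_eq_lintegral_ofReal (hcont.integrable_of_hasCompactSupport hsupp)
      (Eventually.of_forall fun x => by positivity)]
    refine lintegral_congr fun x => ?_
    rw [← ENNReal.ofReal_rpow_of_nonneg (norm_nonneg _) ha.le, ofReal_norm]
  have := ENNReal.tendsto_ofReal (h _ hcont hsupp)
  simpa only [key] using this

lemma lintegral_criticalMeasure {N : ℕ} {p : ℝ} (hq : 0 < pStar N p) {u : E N → ℝ}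
    (hu : AEStronglyMeasurable u volume) {φ : E N → ℝ} (hφ : Continuous φ) :
    ∫⁻ x, ‖φ x‖ₑ ^ pStar N p ∂(criticalMeasure p u) = ∫⁻ x, ‖φ x * u x‖ₑ ^ pStar N p := by
  have hφm : Measurable fun x => ‖φ x‖ₑ ^ pStar N p := by fun_prop
  rw [criticalMeasure, lintegral_withDensity_eq_lintegral_mul₀ (hu.enorm.pow_const _)
    hφm.aemeasurable]
  refine lintegral_congr fun x => ?_
  rw [Pi.mul_apply, enorm_mul, ENNReal.mul_rpow_of_nonneg _ _ hq.le, mul_comm]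

lemma lintegral_criticalMeasure_rpow {N : ℕ} {p : ℝ} (hq : 0 < pStar N p) {u : E N → ℝ}
    (hu : AEStronglyMeasurable u volume) {φ : E N → ℝ} (hφ : Continuous φ) :
    (∫⁻ x, ‖φ x‖ₑ ^ pStar N p ∂(criticalMeasure p u)) ^ (1 / pStar N p) =
      eLpNorm (fun x => φ x * u x) (ENNReal.ofReal (pStar N p)) volume := by
  rw [lintegral_criticalMeasure hq hu hφ, eLpNorm_ofReal_eq hq]

lemma MemW.isFiniteMeasure_criticalMeasure {N : ℕ} {s p : ℝ} (hq : 0 < pStar N p) {u : E N → ℝ}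
    (hu : MemW s p u) : IsFiniteMeasure (criticalMeasure p u) := by
  refine ⟨?_⟩
  rw [criticalMeasure, withDensity_apply _ .univ, Measure.restrict_univ, ← eLpNorm_ofReal_rpow hq]
  exact ENNReal.rpow_lt_top_of_nonneg hq.le hu.memLp.2.ne

/-- The Sobolev inequality localized by a test function and passed to the limit. -/
lemma sobolev_limit_le {N : ℕ} {s p : ℝ} (hs₀ : 0 < s) (hs₁ : s < 1) (hp : 1 < p) (hpN : p < N)
    {u : ℕ → W N s p hp.le} {u₀ : W N s p hp.le} (hbdd : IsBoundedSeq u)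
    (hweak : WeaklyTendsto u u₀) {μ₀ ν₀ : Measure (E N)} [IsFiniteMeasure μ₀] [IsFiniteMeasure ν₀]
    (hμ : WeakStarTendsto (fun n => energyMeasure s p (u n : E N → ℝ)) μ₀)
    (hν : WeakStarTendsto (fun n => criticalMeasure p (u n : E N → ℝ)) ν₀) {c : ℝ≥0}
    (hc : ∀ w ∈ W N s p hp.le, c * eLpNorm w (ENNReal.ofReal (pStar N p)) volume ^ p ≤
      eLpNorm (weakGrad w) (ENNReal.ofReal p) volume ^ p + gagliardo s p w ^ p)
    {φ : E N → ℝ} (hφ : ContDiff ℝ ∞ φ) (hφc : HasCompactSupport φ) :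
    (c : ℝ≥0∞) ^ (1 / p) * (∫⁻ x, ‖φ x‖ₑ ^ pStar N p ∂ν₀) ^ (1 / pStar N p) ≤
      (c : ℝ≥0∞) ^ (1 / p) * (∫⁻ x, ‖φ x‖ₑ ^ pStar N p ∂(criticalMeasure p (u₀ : E N → ℝ))) ^
        (1 / pStar N p) + ((∫⁻ x, ‖φ x‖ₑ ^ p ∂μ₀) ^ (1 / p) +
          (∫⁻ x, ‖φ x‖ₑ ^ p ∂(energyMeasure s p (u₀ : E N → ℝ))) ^ (1 / p)) := by
  have hp0 : 0 < p := by linarith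
  have hN0 : (0 : ℝ) < N := by linarith
  have hN : 0 < N := by exact_mod_cast hN0
  have hq0 := pStar_pos hp hpN
  have : ∀ n, IsFiniteMeasure (energyMeasure s p (u n : E N → ℝ)) := fun n =>
    MemW.isFiniteMeasure_energyMeasure hp.le (u n).2
  have : ∀ n, IsFiniteMeasure (criticalMeasure p (u n : E N → ℝ)) := fun n =>
    MemW.isFiniteMeasure_criticalMeasure hq0 (u n).2
  have hd : (c : ℝ≥0∞) ^ (1 / p) ≠ ⊤ := ENNReal.rpow_ne_top_of_nonneg (by positivity) (by simp)
  set d := (c : ℝ≥0∞) ^ (1 / p)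
  obtain ⟨hgm, ⟨C, hC⟩, hgi⟩ := weight_contDiff_bounds hN hs₀ hs₁ hp0 hφ hφc
  have hR := tendsto_lintegral_rpow_mul hs₀ hp hpN (hbdd.sub_const u₀) hweak.sub_const hgm hC hgi
  have hL : Tendsto (fun n => d * (∫⁻ x, ‖φ x‖ₑ ^ pStar N p
      ∂(criticalMeasure p (u n : E N → ℝ))) ^ (1 / pStar N p)) atTop
      (𝓝 (d * (∫⁻ x, ‖φ x‖ₑ ^ pStar N p ∂ν₀) ^ (1 / pStar N p))) :=
    ENNReal.Tendsto.const_mul ((ENNReal.continuous_rpow_const.tendsto _).comp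
      (hν.tendsto_lintegral hφ.continuous hφc hq0)) (Or.inr hd)
  have hQ := (ENNReal.continuous_rpow_const (y := 1 / p)).tendsto _ |>.comp
    (hμ.tendsto_lintegral hφ.continuous hφc hp0)
  have hR' := (ENNReal.continuous_rpow_const (y := 1 / p)).tendsto _ |>.comp hR
  rw [ENNReal.zero_rpow_of_pos (by positivity)] at hR'
  have hRHS := ((hQ.add_const ((∫⁻ x, ‖φ x‖ₑ ^ p ∂(energyMeasure s p (u₀ : E N → ℝ))) ^
    (1 / p))).add hR').const_add (d * (∫⁻ x, ‖φ x‖ₑ ^ pStar N p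
      ∂(criticalMeasure p (u₀ : E N → ℝ))) ^ (1 / pStar N p))
  rw [add_zero] at hRHS
  refine le_of_tendsto_of_tendsto' hL hRHS fun n => ?_
  have hum : ∀ v : W N s p hp.le, AEStronglyMeasurable (v : E N → ℝ) volume := fun v =>
    (MemW.memLp v.2).1
  rw [lintegral_criticalMeasure_rpow hq0 (hum _) hφ.continuous,
    lintegral_criticalMeasure_rpow hq0 (hum _) hφ.continuous]
  have hφm := hφ.continuous.aestronglyMeasurable (μ := (volume : Measure (E N)))
  set v : E N → ℝ := ((u n - u₀ : W N s p hp.le) : E N → ℝ) with hv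
  have hvW : MemW s p v := (u n - u₀).2
  -- Sobolev is applied to `φ v` and not to `φ u_n`, because the commutator term vanishes in the
  -- limit only for the weakly null part.
  have hsplit : (fun x => φ x * (u n : E N → ℝ) x) =
      (fun x => φ x * (u₀ : E N → ℝ) x) + fun x => φ x * v x := by
    ext x
    simp [hv]
    ring
  have h1 : d * eLpNorm (fun x => φ x * v x) (ENNReal.ofReal (pStar N p)) volume ≤
      (∫⁻ x, ‖φ x‖ₑ ^ p ∂(energyMeasure s p v)) ^ (1 / p) +
        (∫⁻ x, ‖v x‖ₑ ^ p * (‖gradient φ x‖ₑ ^ p + fracDeriv s p φ x)) ^ (1 / p) := by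
    refine le_trans ?_ (energy_mul_le hp.le hvW.2 hφ hφc)
    have h2 := ENNReal.rpow_le_rpow (hc _ (hvW.mul_contDiff hs₀ hs₁ hp hpN hφ hφc))
      (by positivity : 0 ≤ 1 / p)
    rwa [ENNReal.mul_rpow_of_nonneg _ _ (by positivity), rpow_rpow_one_div hp0] at h2
  have h3 : (∫⁻ x, ‖φ x‖ₑ ^ p ∂(energyMeasure s p v)) ^ (1 / p) ≤ _ :=
    lintegral_energyMeasure_sub_le (s := s) hp.le (MemW.hasWeakGradient (u n).2)
      (MemW.hasWeakGradient u₀.2) hφ.continuous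
  calc d * eLpNorm (fun x => φ x * (u n : E N → ℝ) x) (ENNReal.ofReal (pStar N p)) volume
      ≤ d * (eLpNorm (fun x => φ x * (u₀ : E N → ℝ) x) (ENNReal.ofReal (pStar N p)) volume +
        eLpNorm (fun x => φ x * v x) (ENNReal.ofReal (pStar N p)) volume) := by
        gcongr
        rw [hsplit]
        exact eLpNorm_add_le (hφm.mul (hum _)) (hφm.mul hvW.memLp.1)
          (by simpa using one_le_pStar hp hpN)
    _ ≤ _ := by
        rw [mul_add]
        gcongr
        exact h1.trans (add_le_add h3 le_rfl)

/-- A subsequence of a weakly convergent bounded sequence converges almost everywhere. -/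
lemma exists_subseq_tendsto_ae {N : ℕ} {s p : ℝ} (hs₀ : 0 < s) (hp : 1 < p) (hpN : p < N)
    {u : ℕ → W N s p hp.le} {u₀ : W N s p hp.le} (hbdd : IsBoundedSeq u)
    (hweak : WeaklyTendsto u u₀) : ∃ ns : ℕ → ℕ, StrictMono ns ∧
      ∀ᵐ x, Tendsto (fun k => (u (ns k) : E N → ℝ) x) atTop (𝓝 ((u₀ : E N → ℝ) x)) := by
  have hp0 : 0 < p := by linarith
  -- A bounded integrable weight that is positive everywhere: its null sets are Lebesgue null, so
  -- one extraction handles the whole space.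
  set g : E N → ℝ≥0∞ := fun x => ENNReal.ofReal ((1 + ‖x‖) ^ (-((N : ℝ) + 1))) with hg
  have hgm : Measurable g := by fun_prop
  have hg1 : ∀ x, g x ≤ (1 : ℝ≥0) := fun x => by
    rw [ENNReal.coe_one, hg, ENNReal.ofReal_le_one]
    exact Real.rpow_le_one_of_one_le_of_nonpos (by linarith [norm_nonneg x]) (by
      have : (0 : ℝ) ≤ N := N.cast_nonneg
      linarith)
  have hg0 : ∀ x, g x ≠ 0 := fun x => by
    have : 0 < (1 + ‖x‖) ^ (-((N : ℝ) + 1)) :=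
      Real.rpow_pos_of_pos (by linarith [norm_nonneg x]) _
    simpa [hg] using this
  have hgi : ∫⁻ x, g x ≠ ⊤ :=
    (integrable_one_add_norm (μ := (volume : Measure (E N))) (r := (N : ℝ) + 1)
      (by rw [finrank_euclideanSpace_fin]; linarith)).lintegral_lt_top.ne
  have h := tendsto_lintegral_rpow_mul hs₀ hp hpN (hbdd.sub_const u₀) hweak.sub_const
    hgm.aemeasurable hg1 hgi
  have hum : ∀ v : W N s p hp.le, AEStronglyMeasurable (v : E N → ℝ) volume := fun v =>
    (MemW.memLp v.2).1
  have hac := withDensity_absolutelyContinuous (volume : Measure (E N)) g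
  have hL : Tendsto (fun n => eLpNorm ((u n : E N → ℝ) - (u₀ : E N → ℝ)) (ENNReal.ofReal p)
      (volume.withDensity g)) atTop (𝓝 0) := by
    have h1 := (ENNReal.continuous_rpow_const (y := 1 / p)).tendsto _ |>.comp h
    rw [ENNReal.zero_rpow_of_pos (by positivity)] at h1
    refine h1.congr fun n => ?_
    rw [eLpNorm_ofReal_eq hp0, lintegral_withDensity_eq_lintegral_mul₀ hgm.aemeasurable
      (((hum _).sub (hum _)).enorm.pow_const p)]
    simp [mul_comm]
  obtain ⟨ns, hns, hae⟩ := (tendstoInMeasure_of_tendsto_eLpNorm (by simpa using hp0)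
    (fun n => (hum _).mono_ac hac) ((hum _).mono_ac hac) hL).exists_seq_tendsto_ae
  exact ⟨ns, hns, (withDensity_absolutelyContinuous' hgm.aemeasurable
    (Eventually.of_forall hg0)).ae_le hae⟩

/-- Fatou's lemma for `|φ u_n|^{p^*}` along an almost everywhere convergent subsequence. -/
lemma criticalMeasure_le {N : ℕ} {s p : ℝ} (hs₀ : 0 < s) (hp : 1 < p) (hpN : p < N)
    {u : ℕ → W N s p hp.le} {u₀ : W N s p hp.le} (hbdd : IsBoundedSeq u)
    (hweak : WeaklyTendsto u u₀) {ν₀ : Measure (E N)} [IsFiniteMeasure ν₀]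
    (hν : WeakStarTendsto (fun n => criticalMeasure p (u n : E N → ℝ)) ν₀) :
    criticalMeasure p (u₀ : E N → ℝ) ≤ ν₀ := by
  have hq0 := pStar_pos hp hpN
  have : ∀ v : W N s p hp.le, IsFiniteMeasure (criticalMeasure p (v : E N → ℝ)) := fun v =>
    MemW.isFiniteMeasure_criticalMeasure hq0 v.2
  have hum : ∀ v : W N s p hp.le, AEStronglyMeasurable (v : E N → ℝ) volume := fun v =>
    (MemW.memLp v.2).1
  obtain ⟨ns, hns, hae⟩ := exists_subseq_tendsto_ae hs₀ hp hpN hbdd hweak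
  refine measure_le_of_forall_contDiff hq0 fun φ hφ hφc _ => ?_
  rw [← ((hν.tendsto_lintegral hφ.continuous hφc hq0).comp hns.tendsto_atTop).liminf_eq]
  simp only [Function.comp_def, lintegral_criticalMeasure hq0 (hum _) hφ.continuous]
  refine le_trans (lintegral_mono_ae ?_) (lintegral_liminf_le' fun k =>
    (hφ.continuous.aestronglyMeasurable.mul (hum _)).enorm.pow_const _)
  filter_upwards [hae] with x hx
  exact ((ENNReal.continuous_rpow_const.tendsto _).comp (hx.const_mul (φ x)).enorm).liminf_eq.ge

/-! ### Lower semicontinuity of the energy. -/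

lemma liminf_add_liminf_le (a b : ℕ → ℝ≥0∞) :
    liminf a atTop + liminf b atTop ≤ liminf (fun n => a n + b n) atTop := by
  rw [liminf_eq_iSup_iInf_of_nat, liminf_eq_iSup_iInf_of_nat (u := b)]
  refine ENNReal.iSup_add_iSup_le fun n m => le_liminf_of_le (by isBoundedDefault) ?_
  filter_upwards [eventually_ge_atTop n, eventually_ge_atTop m] with i hn hm
  exact add_le_add (iInf₂_le i hn) (iInf₂_le i hm)

lemma enorm_rpow_sub_two_smul {F : Type*} [NormedAddCommGroup F] [NormedSpace ℝ F] {p : ℝ}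
    (hp : 1 < p) (a : F) : ‖‖a‖ ^ (p - 2) • a‖ₑ = ‖a‖ₑ ^ (p - 1) := by
  rcases eq_or_ne a 0 with rfl | ha
  · simp [ENNReal.zero_rpow_of_pos (sub_pos.2 hp)]
  have hn : 0 < ‖a‖ := norm_pos_iff.2 ha
  rw [enorm_smul, Real.enorm_of_nonneg (by positivity), ← ofReal_norm a,
    ENNReal.ofReal_rpow_of_pos hn, ← ENNReal.ofReal_mul (by positivity)]
  congr 1
  nth_rw 2 [← Real.rpow_one ‖a‖]
  rw [← Real.rpow_add hn]
  congr 1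
  ring

/-- The field `φ^p |∇v|^{p-2} ∇v` that tests lower semicontinuity of `∫ φ^p |∇u|^p` at `v`. -/
def dualField {N : ℕ} (p : ℝ) (φ v : E N → ℝ) (x : E N) : E N :=
  ‖φ x‖ ^ p • ‖weakGrad v x‖ ^ (p - 2) • weakGrad v x

lemma enorm_dualField {N : ℕ} {p : ℝ} (hp : 1 < p) (φ v : E N → ℝ) (x : E N) :
    ‖dualField p φ v x‖ₑ = ‖φ x‖ₑ ^ p * ‖weakGrad v x‖ₑ ^ (p - 1) := by
  rw [dualField, enorm_smul, enorm_rpow_sub_two_smul hp, Real.enorm_rpow_of_nonneg (norm_nonneg _)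
    (by linarith), enorm_norm]

lemma aestronglyMeasurable_dualField {N : ℕ} {p : ℝ} (hp : 1 < p) {φ v : E N → ℝ}
    (hφ : Continuous φ) (hv : ∃ G, IsWeakGradient v G) :
    AEStronglyMeasurable (dualField p φ v) volume := by
  have h1 : AEStronglyMeasurable (fun x => ‖φ x‖ ^ p) (volume : Measure (E N)) :=
    (hφ.norm.rpow_const fun _ => Or.inr (by linarith)).aestronglyMeasurable
  have h2 := (weakGrad_spec hv).2.1.aestronglyMeasurable
  have h3 : AEStronglyMeasurable (fun x => ‖weakGrad v x‖ ^ (p - 2)) volume :=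
    (h2.norm.aemeasurable.pow_const (p - 2)).aestronglyMeasurable
  exact h1.smul (h3.smul h2)

/-- Hölder with exponents `p / (p - 1)` and `p`. It makes pairing with the dual field a
`ρ_p`-continuous functional of `w`. -/
lemma exists_lintegral_dualField_mul_le {N : ℕ} {p : ℝ} (hp : 1 < p) {φ v : E N → ℝ}
    (hφ : Continuous φ) (hc : HasCompactSupport φ) (hv : ∃ G, IsWeakGradient v G)
    (hvp : eLpNorm (weakGrad v) (ENNReal.ofReal p) volume < ⊤) :
    ∃ C : ℝ≥0, ∀ w : E N → ℝ, (∃ G, IsWeakGradient w G) →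
      ∫⁻ x, ‖dualField p φ v x‖ₑ * ‖weakGrad w x‖ₑ ≤
        C * eLpNorm (weakGrad w) (ENNReal.ofReal p) volume := by
  have hp0 : 0 < p := by linarith
  obtain ⟨B, hB⟩ := hc.exists_bound_of_continuous hφ
  have hconj : (p / (p - 1)).HolderConjugate p := (Real.HolderConjugate.conjExponent hp).symm
  have hb : ENNReal.ofReal B ^ p ≠ ⊤ := ENNReal.rpow_ne_top_of_nonneg hp0.le (by simp)
  set A := (∫⁻ x, ‖weakGrad v x‖ₑ ^ p) ^ (1 / (p / (p - 1))) with hA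
  have hAt : A ≠ ⊤ := by
    refine ENNReal.rpow_ne_top_of_nonneg (one_div_nonneg.2 hconj.nonneg) ?_
    rw [← eLpNorm_ofReal_rpow hp0]
    exact ENNReal.rpow_ne_top_of_nonneg hp0.le hvp.ne
  have hCt : ENNReal.ofReal B ^ p * A ≠ ⊤ := ENNReal.mul_ne_top hb hAt
  refine ⟨(ENNReal.ofReal B ^ p * A).toNNReal, fun w hw => ?_⟩
  rw [ENNReal.coe_toNNReal hCt]
  have h := ENNReal.lintegral_mul_le_Lp_mul_Lq volume hconj
    ((aemeasurable_enorm_weakGrad hv).pow_const (p - 1)) (aemeasurable_enorm_weakGrad hw)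
  have hexp : (p - 1) * (p / (p - 1)) = p := by
    have : p - 1 ≠ 0 := by linarith
    field_simp
  simp only [Pi.mul_apply, ← ENNReal.rpow_mul, hexp, ← hA] at h
  calc ∫⁻ x, ‖dualField p φ v x‖ₑ * ‖weakGrad w x‖ₑ
      ≤ ∫⁻ x, ENNReal.ofReal B ^ p * (‖weakGrad v x‖ₑ ^ (p - 1) * ‖weakGrad w x‖ₑ) := by
        refine lintegral_mono fun x => ?_
        simp only
        rw [enorm_dualField hp, mul_assoc]
        gcongr
        rw [← ofReal_norm]
        exact ENNReal.ofReal_le_ofReal (hB x)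
    _ = ENNReal.ofReal B ^ p * ∫⁻ x, ‖weakGrad v x‖ₑ ^ (p - 1) * ‖weakGrad w x‖ₑ :=
        lintegral_const_mul' _ _ hb
    _ ≤ ENNReal.ofReal B ^ p * (A * eLpNorm (weakGrad w) (ENNReal.ofReal p) volume) := by
        rw [eLpNorm_ofReal_eq hp0]
        gcongr
    _ = _ := by rw [mul_assoc]

lemma enorm_inner_le {F : Type*} [NormedAddCommGroup F] [InnerProductSpace ℝ F] (a b : F) :
    ‖inner ℝ a b‖ₑ ≤ ‖a‖ₑ * ‖b‖ₑ := by
  rw [← ofReal_norm, ← ofReal_norm a, ← ofReal_norm b, ← ENNReal.ofReal_mul (norm_nonneg _)]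
  exact ENNReal.ofReal_le_ofReal (norm_inner_le_norm a b)

lemma MemW.eLpNorm_weakGrad_lt_top {N : ℕ} {s p : ℝ} {u : E N → ℝ} (hu : MemW s p u) :
    eLpNorm (weakGrad u) (ENNReal.ofReal p) volume < ⊤ :=
  (ENNReal.add_lt_top.1 hu.rho_lt_top).1

lemma tendsto_enorm_integral_inner_dualField {N : ℕ} {s p : ℝ} (hp : 1 < p)
    {u : ℕ → W N s p hp.le} {u₀ : W N s p hp.le} (hweak : WeaklyTendsto u u₀) {φ : E N → ℝ}
    (hφ : Continuous φ) (hc : HasCompactSupport φ) :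
    Tendsto (fun n => ‖∫ x, inner ℝ (dualField p φ (u₀ : E N → ℝ) x)
      (weakGrad (u n : E N → ℝ) x)‖ₑ) atTop
      (𝓝 (∫⁻ x, (‖φ x‖ₑ * ‖weakGrad (u₀ : E N → ℝ) x‖ₑ) ^ p)) := by
  have hp0 : 0 < p := by linarith
  have hW : ∀ v : W N s p hp.le, MemW s p (v : E N → ℝ) := fun v => v.2
  obtain ⟨C, hC⟩ := exists_lintegral_dualField_mul_le hp hφ hc (hW u₀).2
    (hW u₀).eLpNorm_weakGrad_lt_top
  set H := dualField p φ (u₀ : E N → ℝ) with hH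
  have hHm : AEStronglyMeasurable H volume := aestronglyMeasurable_dualField hp hφ (hW u₀).2
  have hle : ∀ v : W N s p hp.le, ∫⁻ x, ‖inner ℝ (H x) (weakGrad (v : E N → ℝ) x)‖ₑ ≤
      C * rho s p (v : E N → ℝ) := fun v => by
    refine (lintegral_mono fun x => enorm_inner_le _ _).trans ((hC _ (hW v).2).trans ?_)
    gcongr
    exact le_self_add
  have hint : ∀ v : W N s p hp.le,
      Integrable (fun x => inner ℝ (H x) (weakGrad (v : E N → ℝ) x)) volume := fun v =>
    ⟨hHm.inner (weakGrad_spec (hW v).2).2.1.aestronglyMeasurable,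
      (hle v).trans_lt (ENNReal.mul_lt_top ENNReal.coe_lt_top (hW v).rho_lt_top)⟩
  let F : W N s p hp.le →ₗ[ℝ] ℝ :=
    { toFun := fun v => ∫ x, inner ℝ (H x) (weakGrad (v : E N → ℝ) x)
      -- The weak gradient is a chosen representative, so linearity holds only almost everywhere,
      -- which suffices under the integral.
      map_add' := fun v v' => by
        rw [← integral_add (hint v) (hint v')]
        refine integral_congr_ae ?_
        filter_upwards [((weakGrad_spec (hW v).2).add (weakGrad_spec (hW v').2)).ae_eq] with x hx
        rw [← inner_add_right]
        exact congrArg _ hx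
      map_smul' := fun c v => by
        rw [RingHom.id_apply, smul_eq_mul, ← integral_const_mul]
        refine integral_congr_ae ?_
        filter_upwards [((weakGrad_spec (hW v).2).smul c).ae_eq] with x hx
        rw [← real_inner_smul_right]
        exact congrArg _ hx }
  have h := (hweak F ⟨C, fun v => (enorm_integral_le_lintegral_enorm _).trans (hle v)⟩).enorm
  have h0 : ‖F u₀‖ₑ = ∫⁻ x, (‖φ x‖ₑ * ‖weakGrad (u₀ : E N → ℝ) x‖ₑ) ^ p := by
    have hpt : ∀ x, inner ℝ (H x) (weakGrad (u₀ : E N → ℝ) x) =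
        ‖φ x‖ ^ p * ‖weakGrad (u₀ : E N → ℝ) x‖ ^ p := fun x => by
      rw [hH, dualField, real_inner_smul_left, real_inner_smul_left, real_inner_self_eq_norm_sq]
      rcases eq_or_ne ‖weakGrad (u₀ : E N → ℝ) x‖ 0 with h0 | h0
      · simp [h0, hp0.ne']
      · have hpos : 0 < ‖weakGrad (u₀ : E N → ℝ) x‖ := lt_of_le_of_ne (norm_nonneg _) h0.symm
        rw [← Real.rpow_natCast, ← Real.rpow_add hpos]
        norm_num
    have hnn : ∀ x, 0 ≤ inner ℝ (H x) (weakGrad (u₀ : E N → ℝ) x) := fun x => by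
      rw [hpt]
      positivity
    change ‖∫ x, inner ℝ (H x) (weakGrad (u₀ : E N → ℝ) x)‖ₑ = _
    rw [Real.enorm_of_nonneg (integral_nonneg hnn),
      ofReal_integral_eq_lintegral_ofReal (hint u₀) (Eventually.of_forall hnn)]
    refine lintegral_congr fun x => ?_
    rw [hpt, ENNReal.ofReal_mul (by positivity), ← ENNReal.ofReal_rpow_of_nonneg (norm_nonneg _)
      hp0.le, ← ENNReal.ofReal_rpow_of_nonneg (norm_nonneg _) hp0.le, ofReal_norm, ofReal_norm,
      ENNReal.mul_rpow_of_nonneg _ _ hp0.le]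
  rw [h0] at h
  exact h

/-- Pointwise Young inequality for `(|φ| |∇v|)^{p-1}` and `|φ| |∇w|`. It is an equality for `w = v`,
so nothing is lost in the limit. -/
lemma enorm_integral_inner_dualField_le {N : ℕ} {p : ℝ} (hp : 1 < p) {φ v w : E N → ℝ}
    (hφ : Continuous φ) (hv : ∃ G, IsWeakGradient v G) :
    ‖∫ x, inner ℝ (dualField p φ v x) (weakGrad w x)‖ₑ ≤
      (∫⁻ x, (‖φ x‖ₑ * ‖weakGrad v x‖ₑ) ^ p) / ENNReal.ofReal (p / (p - 1)) +
        (∫⁻ x, (‖φ x‖ₑ * ‖weakGrad w x‖ₑ) ^ p) / ENNReal.ofReal p := by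
  have hp0 : 0 < p := by linarith
  have hconj : (p / (p - 1)).HolderConjugate p := (Real.HolderConjugate.conjExponent hp).symm
  have hexp : (p - 1) * (p / (p - 1)) = p := by
    have : p - 1 ≠ 0 := by linarith
    field_simp
  have hφm : AEMeasurable (fun x => ‖φ x‖ₑ) (volume : Measure (E N)) := by fun_prop
  have hm : AEMeasurable (fun x => (‖φ x‖ₑ * ‖weakGrad v x‖ₑ) ^ p / ENNReal.ofReal (p / (p - 1)))
      volume := ((hφm.mul (aemeasurable_enorm_weakGrad hv)).pow_const p).div_const _
  have hinv : ∀ t : ℝ, 0 < t → (ENNReal.ofReal t)⁻¹ ≠ ⊤ := fun t ht => by simpa using ht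
  calc _ ≤ ∫⁻ x, ‖inner ℝ (dualField p φ v x) (weakGrad w x)‖ₑ :=
        enorm_integral_le_lintegral_enorm _
    _ ≤ ∫⁻ x, (‖φ x‖ₑ * ‖weakGrad v x‖ₑ) ^ p / ENNReal.ofReal (p / (p - 1)) +
        (‖φ x‖ₑ * ‖weakGrad w x‖ₑ) ^ p / ENNReal.ofReal p := by
        refine lintegral_mono fun x => ?_
        refine (enorm_inner_le _ _).trans ?_
        have h := ENNReal.young_inequality ((‖φ x‖ₑ * ‖weakGrad v x‖ₑ) ^ (p - 1))
          (‖φ x‖ₑ * ‖weakGrad w x‖ₑ) hconj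
        rw [← ENNReal.rpow_mul, hexp] at h
        refine le_trans (le_of_eq ?_) h
        rw [enorm_dualField hp, ENNReal.mul_rpow_of_nonneg _ _ (by linarith)]
        have h2 : ‖φ x‖ₑ ^ p = ‖φ x‖ₑ ^ (p - 1) * ‖φ x‖ₑ := by
          nth_rw 3 [← ENNReal.rpow_one ‖φ x‖ₑ]
          rw [← ENNReal.rpow_add_of_nonneg _ _ (by linarith) zero_le_one, sub_add_cancel]
        rw [h2]
        ring
    _ = _ := by
        rw [lintegral_add_left' hm]
        simp only [ENNReal.div_eq_inv_mul]
        rw [lintegral_const_mul' _ _ (hinv _ hconj.pos), lintegral_const_mul' _ _ (hinv _ hp0)]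

lemma lintegral_diffQuot_le_liminf {N : ℕ} {s p : ℝ} {f : ℕ → E N → ℝ}
    {w φ : E N → ℝ} (hφ : Continuous φ) (hf : ∀ k, AEStronglyMeasurable (f k) volume)
    (h : ∀ᵐ x, Tendsto (fun k => f k x) atTop (𝓝 (w x))) :
    ∫⁻ z : E N × E N, (‖φ z.1‖ₑ * diffQuot s p w z) ^ p ∂(volume.prod volume) ≤
      liminf (fun k => ∫⁻ z : E N × E N, (‖φ z.1‖ₑ * diffQuot s p (f k) z) ^ p
        ∂(volume.prod volume)) atTop := by
  have hm : AEMeasurable (fun z : E N × E N => ‖φ z.1‖ₑ) (volume.prod volume) := by fun_prop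
  refine le_trans ?_ (lintegral_liminf_le' fun k =>
    (hm.mul (aemeasurable_diffQuot (hf k))).pow_const p)
  have h1 : ∀ᵐ z : E N × E N ∂(volume.prod volume),
      Tendsto (fun k => f k z.1) atTop (𝓝 (w z.1)) := Measure.quasiMeasurePreserving_fst.ae h
  have h2 : ∀ᵐ z : E N × E N ∂(volume.prod volume),
      Tendsto (fun k => f k z.2) atTop (𝓝 (w z.2)) := Measure.quasiMeasurePreserving_snd.ae h
  refine lintegral_mono_ae ?_
  filter_upwards [h1, h2] with z hz1 hz2
  refine (Tendsto.liminf_eq ?_).ge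
  refine (ENNReal.continuous_rpow_const.tendsto _).comp ?_
  refine ENNReal.Tendsto.const_mul ?_ (Or.inr enorm_ne_top)
  by_cases hz : z.1 = z.2
  · simp [diffQuot, hz]
  simp only [diffQuot, div_eq_mul_inv]
  refine ENNReal.Tendsto.mul_const (hz1.sub hz2).enorm (Or.inr ?_)
  simp [ENNReal.rpow_eq_zero_iff, sub_eq_zero, hz]

/-- The gradients converge only weakly and are handled by Young's inequality against the dual field
of `u₀`; the nonlocal part is handled by Fatou. Only the limit of the sum of the two energies is
known, so both are estimated together. -/
lemma energyMeasure_le {N : ℕ} {s p : ℝ} (hs₀ : 0 < s) (hp : 1 < p) (hpN : p < N)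
    {u : ℕ → W N s p hp.le} {u₀ : W N s p hp.le} (hbdd : IsBoundedSeq u)
    (hweak : WeaklyTendsto u u₀) {μ₀ : Measure (E N)} [IsFiniteMeasure μ₀]
    (hμ : WeakStarTendsto (fun n => energyMeasure s p (u n : E N → ℝ)) μ₀) :
    energyMeasure s p (u₀ : E N → ℝ) ≤ μ₀ := by
  have hp0 : 0 < p := by linarith
  have hW : ∀ v : W N s p hp.le, MemW s p (v : E N → ℝ) := fun v => v.2
  have hfin : ∀ v : W N s p hp.le, IsFiniteMeasure (energyMeasure s p (v : E N → ℝ)) := fun v =>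
    (hW v).isFiniteMeasure_energyMeasure hp.le
  obtain ⟨ns, hns, hae⟩ := exists_subseq_tendsto_ae hs₀ hp hpN hbdd hweak
  refine measure_le_of_forall_contDiff hp0 fun φ hφ hφc _ => ?_
  have hφ := hφ.continuous
  set T := ∫⁻ x, ‖φ x‖ₑ ^ p ∂μ₀
  have hT := (hμ.tendsto_lintegral hφ hφc hp0).comp hns.tendsto_atTop
  set A := ∫⁻ x, (‖φ x‖ₑ * ‖weakGrad (u₀ : E N → ℝ) x‖ₑ) ^ p with hA
  set B : (E N → ℝ) → ℝ≥0∞ := fun v =>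
    ∫⁻ z : E N × E N, (‖φ z.1‖ₑ * diffQuot s p v z) ^ p ∂(volume.prod volume) with hBdef
  have hF := (tendsto_enorm_integral_inner_dualField hp hweak hφ hφc).comp hns.tendsto_atTop
  have hB : B u₀ ≤ liminf (fun k => B (u (ns k))) atTop :=
    lintegral_diffQuot_le_liminf hφ (fun k => (hW _).memLp.1) hae
  rw [lintegral_energyMeasure hp0 (hW u₀).2 hφ]
  change A + B u₀ ≤ T
  have hAt : A ≠ ⊤ := by
    have h1 : A + B u₀ ≠ ⊤ := by
      rw [hA, hBdef, ← lintegral_energyMeasure hp0 (hW u₀).2 hφ]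
      obtain ⟨b, hb⟩ := hφc.exists_bound_of_continuous hφ
      refine ne_top_of_le_ne_top ?_ (lintegral_mono fun x => ENNReal.rpow_le_rpow
        (show ‖φ x‖ₑ ≤ ENNReal.ofReal b by
          rw [← ofReal_norm]; exact ENNReal.ofReal_le_ofReal (hb x)) hp0.le)
      rw [lintegral_const]
      exact ENNReal.mul_ne_top (ENNReal.rpow_ne_top_of_nonneg hp0.le (by simp)) (measure_ne_top _ _)
    exact (ENNReal.add_ne_top.1 h1).1
  set a := (ENNReal.ofReal (p / (p - 1)))⁻¹ with ha
  set b := (ENNReal.ofReal p)⁻¹ with hb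
  have hpp : 0 < p / (p - 1) := div_pos hp0 (by linarith)
  have hb0 : b ≠ 0 := by simp [hb]
  have hbt : b ≠ ⊤ := by simpa [hb] using hp0
  have hat : a ≠ ⊤ := by simpa [ha] using hpp
  have hab : a + b = 1 := by
    rw [ha, hb, ← ENNReal.ofReal_inv_of_pos hpp, ← ENNReal.ofReal_inv_of_pos hp0,
      ← ENNReal.ofReal_add (by positivity) (by positivity), ENNReal.ofReal_eq_one]
    have : p - 1 ≠ 0 := by linarith
    field_simp
    ring
  -- The nonlocal energy receives the same factor `b = 1/p` that Young's inequality puts on the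
  -- gradient energy, so the full energy appears on the right.
  have hstep : ∀ k, ‖∫ x, inner ℝ (dualField p φ (u₀ : E N → ℝ) x)
      (weakGrad (u (ns k) : E N → ℝ) x)‖ₑ + B (u (ns k)) * b ≤
      A * a + (∫⁻ x, ‖φ x‖ₑ ^ p ∂(energyMeasure s p (u (ns k) : E N → ℝ))) * b := fun k => by
    rw [lintegral_energyMeasure hp0 (hW _).2 hφ, add_mul, ← add_assoc]
    gcongr
    exact enorm_integral_inner_dualField_le hp hφ (hW u₀).2
  have hlim : A + B u₀ * b ≤ A * a + T * b := by
    have h1 := (ENNReal.Tendsto.mul_const (b := b) hT (Or.inr hbt)).const_add (A * a)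
    have hmono : Monotone fun t : ℝ≥0∞ => t * b := fun _ _ h => mul_le_mul_left h b
    have h2 : B u₀ * b ≤ liminf (fun k => B (u (ns k)) * b) atTop := by
      have h3 := hmono.map_liminf_of_continuousAt (F := atTop) (fun k => B (u (ns k)))
        (ENNReal.continuous_mul_const hbt).continuousAt
      exact (hmono hB).trans_eq h3
    rw [← h1.liminf_eq]
    refine (add_le_add hF.liminf_eq.ge h2).trans ((liminf_add_liminf_le _ _).trans ?_)
    exact liminf_le_liminf (Eventually.of_forall hstep)
  -- Since `a + b = 1`, the finite term `A * a` cancels and the remaining inequality can be divided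
  -- by `b`.
  have hA2 : A = A * a + A * b := by rw [← mul_add, hab, mul_one]
  have hAa : A * a ≠ ⊤ := ENNReal.mul_ne_top hAt hat
  have hlim2 : A * a + (A + B u₀) * b ≤ A * a + T * b := by
    rw [add_mul, ← add_assoc, ← hA2]
    exact hlim
  rw [ENNReal.add_le_add_iff_left hAa] at hlim2
  exact (ENNReal.mul_le_mul_iff_left hb0 hbt).1 hlim2

/-! ### Atomic parts and the decomposition of the limit measures. -/

lemma sum_measure_singleton_smul_dirac {X : Type*} [MeasurableSpace X]
    [MeasurableSingletonClass X] (m : Measure X) {S : Set X} (hS : S.Countable) :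
    Measure.sum (fun j : S => m {(j : X)} • Measure.dirac (j : X)) = m.restrict S := by
  have := hS.to_subtype
  conv_rhs => rw [← Set.iUnion_of_singleton_coe S]
  rw [Measure.restrict_iUnion (fun i j hij => by
    simpa [Function.onFun, Subtype.ext_iff] using hij) fun i => measurableSet_singleton _]
  simp only [Measure.restrict_singleton]

lemma exists_pos_sobolevConst {N : ℕ} {s p : ℝ} (hs : 0 < s) (hp : 1 < p) (hpN : p < N) :
    ∃ c : ℝ≥0, c ≠ 0 ∧ ∀ w ∈ W N s p hp.le,
      c * eLpNorm w (ENNReal.ofReal (pStar N p)) volume ^ p ≤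
        eLpNorm (weakGrad w) (ENNReal.ofReal p) volume ^ p + gagliardo s p w ^ p := by
  have hp0 : 0 < p := by linarith
  obtain ⟨K, hK⟩ := exists_sobolev (N := N) hs hp hpN
  -- `K + 1` replaces `K`, which might be zero, because its `p`-th power is inverted.
  have hK1 : 0 < K + 1 := by positivity
  refine ⟨((K + 1) ^ p)⁻¹, by positivity, fun w hw => le_self_add.trans' ?_⟩
  have h : eLpNorm w (ENNReal.ofReal (pStar N p)) volume ≤
      ((K + 1 : ℝ≥0) : ℝ≥0∞) * eLpNorm (weakGrad w) (ENNReal.ofReal p) volume :=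
    (hK w hw).trans (by gcongr; exact le_self_add)
  have hKp : (K + 1) ^ p ≠ 0 := by positivity
  rw [ENNReal.coe_inv hKp, mul_comm, ← div_eq_mul_inv]
  refine ENNReal.div_le_of_le_mul' ?_
  rw [ENNReal.coe_rpow_of_nonneg _ hp0.le, ← ENNReal.mul_rpow_of_nonneg _ _ hp0.le]
  exact ENNReal.rpow_le_rpow h hp0.le

end MixedSobolev

end

open MixedSobolev in
theorem proposition3 (N : ℕ) (s p : ℝ) (hs₀ : 0 < s) (hs₁ : s < 1) (hp : 1 < p) (hpN : p < N)
    (u : ℕ → MixedSobolev.W N s p hp.le) (u₀ : MixedSobolev.W N s p hp.le)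
    (hbdd : MixedSobolev.IsBoundedSeq u) (hweak : MixedSobolev.WeaklyTendsto u u₀)
    (μ₀ ν₀ : Measure (MixedSobolev.E N)) [IsFiniteMeasure μ₀] [IsFiniteMeasure ν₀]
    (hμ : MixedSobolev.WeakStarTendsto
      (fun n => MixedSobolev.energyMeasure s p (u n : MixedSobolev.E N → ℝ)) μ₀)
    (hν : MixedSobolev.WeakStarTendsto
      (fun n => MixedSobolev.criticalMeasure p (u n : MixedSobolev.E N → ℝ)) ν₀) :
    ∃ (J : Type) (_ : Countable J) (x : J → MixedSobolev.E N) (μ ν : J → ℝ≥0∞),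
      (∀ j, 0 < μ j ∧ μ j = μ₀ {x j}) ∧
      (∀ j, 0 < ν j ∧ ν j = ν₀ {x j}) ∧
      MixedSobolev.energyMeasure s p (u₀ : MixedSobolev.E N → ℝ) +
        Measure.sum (fun j => μ j • Measure.dirac (x j)) ≤ μ₀ ∧
      ν₀ = MixedSobolev.criticalMeasure p (u₀ : MixedSobolev.E N → ℝ) +
        Measure.sum (fun j => ν j • Measure.dirac (x j)) ∧
      ∀ j, MixedSobolev.bestConst N s p hp.le * ν j ^ (p / MixedSobolev.pStar N p) ≤ μ j := by
  have hp0 : 0 < p := by linarith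
  have hq0 := pStar_pos hp hpN
  have := nontrivial_of_lt hp hpN
  have hW₀ : MemW s p (u₀ : E N → ℝ) := u₀.2
  have := hW₀.isFiniteMeasure_energyMeasure hp.le
  have := hW₀.isFiniteMeasure_criticalMeasure hq0
  have hσν : criticalMeasure p (u₀ : E N → ℝ) ≤ ν₀ := criticalMeasure_le hs₀ hp hpN hbdd hweak hν
  have heμ : energyMeasure s p (u₀ : E N → ℝ) ≤ μ₀ := energyMeasure_le hs₀ hp hpN hbdd hweak hμ
  have hσac : criticalMeasure p (u₀ : E N → ℝ) ≪ volume := withDensity_absolutelyContinuous _ _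
  have heac : energyMeasure s p (u₀ : E N → ℝ) ≪ volume := withDensity_absolutelyContinuous _ _
  set σ := criticalMeasure p (u₀ : E N → ℝ)
  set e := energyMeasure s p (u₀ : E N → ℝ)
  have hsob : ∀ c : ℝ≥0, (∀ w ∈ W N s p hp.le,
      c * eLpNorm w (ENNReal.ofReal (pStar N p)) volume ^ p ≤
        eLpNorm (weakGrad w) (ENNReal.ofReal p) volume ^ p + gagliardo s p w ^ p) →
      ∀ A, MeasurableSet A → (c : ℝ≥0∞) ^ (1 / p) * ν₀ A ^ (1 / pStar N p) ≤
        (c : ℝ≥0∞) ^ (1 / p) * σ A ^ (1 / pStar N p) + (μ₀ A ^ (1 / p) + e A ^ (1 / p)) :=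
    fun c hc A hA => measure_rpow_le_of_forall_contDiff hp0 hq0
      (ENNReal.rpow_ne_top_of_nonneg (by positivity) (by simp))
      (fun φ hφ hφc _ => sobolev_limit_le hs₀ hs₁ hp hpN hbdd hweak hμ hν hc hφ hφc) hA
  -- At a point the absolutely continuous measures `σ` and `e` vanish, so the wasteful terms
  -- disappear and the constant is not degraded.
  have hatom : ∀ c : ℝ≥0, (∀ w ∈ W N s p hp.le,
      c * eLpNorm w (ENNReal.ofReal (pStar N p)) volume ^ p ≤
        eLpNorm (weakGrad w) (ENNReal.ofReal p) volume ^ p + gagliardo s p w ^ p) →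
      ∀ x, (c : ℝ≥0∞) * ν₀ {x} ^ (p / pStar N p) ≤ μ₀ {x} := by
    intro c hc x
    have h := hsob c hc {x} (measurableSet_singleton x)
    rw [hσac (measure_singleton x), heac (measure_singleton x),
      ENNReal.zero_rpow_of_pos (by positivity), ENNReal.zero_rpow_of_pos (by positivity), mul_zero,
      zero_add, add_zero] at h
    have h2 := ENNReal.rpow_le_rpow h hp0.le
    rwa [ENNReal.mul_rpow_of_nonneg _ _ hp0.le, rpow_one_div_rpow hp0, rpow_one_div_rpow hp0,
      ← ENNReal.rpow_mul, one_div_mul_eq_div] at h2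
  obtain ⟨c₀, hc₀, hc₀W⟩ := exists_pos_sobolevConst (N := N) hs₀ hp hpN
  set S : Set (E N) := {x | ν₀ {x} ≠ 0}
  have hS : S.Countable := countable_setOf_measure_singleton_ne_zero ν₀
  have hSm : MeasurableSet S := hS.measurableSet
  set D : Set (E N) := {x | (μ₀ + e) {x} ≠ 0}
  have hD : D.Countable := countable_setOf_measure_singleton_ne_zero (μ₀ + e)
  have hd0 : (c₀ : ℝ≥0∞) ^ (1 / p) ≠ 0 := by simp [hc₀, hp0.not_gt]
  have hdt : (c₀ : ℝ≥0∞) ^ (1 / p) ≠ ⊤ := ENNReal.rpow_ne_top_of_nonneg (by positivity) (by simp)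
  -- Any positive finite admissible constant serves here; sharpness matters only at the atoms.
  have hdiff : ∀ B, MeasurableSet B → Disjoint B D → ν₀ B ≤ σ B := by
    intro B hB hBD
    refine measure_le_of_rpow_le_of_no_atoms (m := μ₀ + e) (K := ((c₀ : ℝ≥0∞) ^ (1 / p))⁻¹ * 2) hp0
      (lt_pStar hp hpN) (one_le_pStar hp hpN)
      (ENNReal.mul_ne_top (ENNReal.inv_ne_top.2 hd0) (by simp)) (fun A hA => ?_) hB fun x hx => ?_
    · have h := hsob c₀ hc₀W A hA
      have h2 : μ₀ A ^ (1 / p) + e A ^ (1 / p) ≤ 2 * (μ₀ + e) A ^ (1 / p) := by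
        rw [two_mul, Measure.add_apply]
        gcongr
        exacts [le_self_add, le_add_self]
      rw [← ENNReal.mul_le_mul_iff_right hd0 hdt, mul_add, mul_assoc,
        ENNReal.mul_inv_cancel_left hd0 hdt]
      exact h.trans (by gcongr)
    · by_contra h
      exact Set.disjoint_left.1 hBD hx h
  have hσ : σ = ν₀.restrict Sᶜ := by
    refine le_antisymm ?_ (Measure.le_iff.2 fun A hA => ?_)
    · have h0 : σ.restrict Sᶜ = σ :=
        Measure.restrict_eq_self_of_ae_mem (measure_eq_zero_iff_ae_notMem.1 (hσac (hS.measure_zero volume)))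
      rw [← h0]
      exact Measure.restrict_mono_measure hσν _
    · rw [Measure.restrict_apply hA]
      -- An atom of `μ₀ + e` need not be one of `ν₀`; outside `S` there are countably many such
      -- points, each `ν₀`-null.
      have hz : ν₀ (A ∩ Sᶜ ∩ D) = 0 := by
        have hcount : (A ∩ Sᶜ ∩ D).Countable := hD.mono Set.inter_subset_right
        rw [← Set.biUnion_of_singleton (A ∩ Sᶜ ∩ D), measure_biUnion_null_iff hcount]
        intro x hx
        by_contra h
        exact hx.1.2 h
      calc ν₀ (A ∩ Sᶜ) ≤ ν₀ (A ∩ Sᶜ ∩ D) + ν₀ ((A ∩ Sᶜ) \ D) := measure_le_inter_add_sdiff _ _ _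
        _ = ν₀ ((A ∩ Sᶜ) \ D) := by rw [hz, zero_add]
        _ ≤ σ ((A ∩ Sᶜ) \ D) :=
            hdiff _ ((hA.inter hSm.compl).diff hD.measurableSet) Set.disjoint_sdiff_left
        _ ≤ σ A := measure_mono (Set.sdiff_subset.trans Set.inter_subset_left)
  refine ⟨S, hS.to_subtype, fun j => j, fun j => μ₀ {(j : E N)}, fun j => ν₀ {(j : E N)},
    fun j => ⟨?_, rfl⟩, fun j => ⟨pos_iff_ne_zero.2 j.2, rfl⟩, ?_, ?_, fun j => ?_⟩
  · refine lt_of_lt_of_le ?_ (hatom c₀ hc₀W j)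
    refine ENNReal.mul_pos (by simpa using hc₀) ?_
    exact (ENNReal.rpow_pos (pos_iff_ne_zero.2 j.2) (measure_ne_top _ _)).ne'
  · rw [sum_measure_singleton_smul_dirac μ₀ hS]
    have h0 : e.restrict Sᶜ = e :=
      Measure.restrict_eq_self_of_ae_mem (measure_eq_zero_iff_ae_notMem.1 (heac (hS.measure_zero volume)))
    -- `e` ignores the countable set `S`, so `e ≤ μ₀` is used only on its complement and no mass is
    -- counted twice.
    calc e + μ₀.restrict S ≤ μ₀.restrict Sᶜ + μ₀.restrict S := by
          rw [← h0]
          exact add_le_add (Measure.restrict_mono_measure heμ _) le_rfl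
      _ = μ₀ := Measure.restrict_compl_add_restrict hSm
  · rw [sum_measure_singleton_smul_dirac ν₀ hS, hσ, Measure.restrict_compl_add_restrict hSm]
  · have hν0 : ν₀ {(j : E N)} ^ (p / pStar N p) ≠ 0 :=
      (ENNReal.rpow_pos (pos_iff_ne_zero.2 j.2) (measure_ne_top _ _)).ne'
    have hνt : ν₀ {(j : E N)} ^ (p / pStar N p) ≠ ⊤ :=
      ENNReal.rpow_ne_top_of_nonneg (by positivity) (measure_ne_top _ _)
    rw [← ENNReal.le_div_iff_mul_le (Or.inl hν0) (Or.inl hνt), bestConst]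
    -- The atomic inequality is available for finite constants; every finite `c < C` inherits
    -- admissibility from `C`.
    refine sSup_le fun C hC => ENNReal.le_of_forall_nnreal_lt fun c hc => ?_
    rw [ENNReal.le_div_iff_mul_le (Or.inl hν0) (Or.inl hνt)]
    exact hatom c (fun w hw => (hC w hw).trans' (by gcongr)) j
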